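/- Graphs are finite and loopless but may have parallel edges. A graph is subcubic if every vertex has degree at most $3$. A graph is $2$-connected if it has at least two vertices, is connected, and remains connected after the deletion of any single vertex and after the deletion of any single edge (for graphs with at least three vertices this means: connected without a cut vertex; a graph on two vertices is $2$-connected if and only if it has at least two parallel edges). A star edge-coloring of a graph $G$ is a proper edge-coloring of $G$ (distinct edges with a common end, in particular parallel edges, receive distinct colors) in which no path with four edges and no cycle with four edges is bichromatic, i.e. has edges of exactly two colors. For an integer $k$, the graph $G$ is star $k$-edge-choosable if for every assignment $L$ of a finite list $L(e)$ of colors to each edge $e$ of $G$ with $|L(e)| \ge k$ for all $e \in E(G)$, there is a star edge-coloring $\sigma$ of $G$ with $\sigma(e) \in L(e)$ for every $e \in E(G)$. **Lemma.** Every $2$-connected subcubic graph is star $7$-edge-choosable. -/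

import Mathlib

/-! Multigraphs are Mathlib's `Graph α β` (parallel edges allowed; loops are excluded in the theorem
by `Graph.Loopless`). -/

universe u v w

namespace Graph

/-- A (multi)graph is connected if it has a vertex and any two of its vertices are joined by a
walk. -/
def IsConnected {α β : Type*} (G : Graph α β) : Prop :=
  G.vertexSet.Nonempty ∧
    ∀ x ∈ G.vertexSet, ∀ y ∈ G.vertexSet, Relation.ReflTransGen G.Adj x y

/-- 2-connectedness of a (multi)graph: it has at least two vertices, it is connected, and it stays
connected after the deletion of any one vertex and after the deletion of any one edge.

On three or more vertices the condition on edges follows from the one on vertices, so that this is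
the usual "connected, at least three vertices and no cut vertex". On two vertices it says that the
two vertices are joined by at least two parallel edges; so a single edge is not 2-connected. -/
structure IsTwoConnected {α β : Type*} (G : Graph α β) : Prop where
  nontrivial : G.vertexSet.Nontrivial
  connected : G.IsConnected
  connected_deleteVert : ∀ x ∈ G.vertexSet, (G.deleteVerts {x}).IsConnected
  connected_deleteEdge : ∀ e ∈ G.edgeSet, (G.deleteEdges {e}).IsConnected

/-- Every vertex is incident with at most three edges. (In a loopless graph the degree of a vertex
is the number of edges incident with it.) -/
def IsSubcubic {α β : Type*} (G : Graph α β) : Prop :=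
  ∀ x ∈ G.vertexSet, (G.incidenceSet x).encard ≤ 3

/-- `e 0, e 1, e 2, e 3` are the consecutive edges of a path of length four
(on five distinct vertices). -/
def IsFourPath {α β : Type*} (G : Graph α β) (e : Fin 4 → G.edgeSet) : Prop :=
  ∃ x : Fin 5 → α, Function.Injective x ∧
    ∀ i : Fin 4, G.IsLink (e i : β) (x i.castSucc) (x i.succ)

/-- `e 0, e 1, e 2, e 3` are the consecutive edges of a cycle of length four
(on four distinct vertices; the addition `i + 1` is modulo 4). -/
def IsFourCycle {α β : Type*} (G : Graph α β) (e : Fin 4 → G.edgeSet) : Prop :=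
  ∃ x : Fin 4 → α, Function.Injective x ∧
    ∀ i : Fin 4, G.IsLink (e i : β) (x i) (x (i + 1))

/-- Proper edge-coloring: distinct edges with a common end (in particular, parallel edges) have
distinct colors. -/
def IsProperEdgeColoring {α β C : Type*} (G : Graph α β) (σ : G.edgeSet → C) : Prop :=
  ∀ e f : G.edgeSet, e ≠ f → ∀ x : α, G.Inc (e : β) x → G.Inc (f : β) x → σ e ≠ σ f

/-- Star edge-coloring: a proper edge-coloring in which no path and no cycle of length four is
bichromatic, that is, has edges of exactly two colors. -/
structure IsStarEdgeColoring {α β C : Type*} (G : Graph α β) (σ : G.edgeSet → C) : Prop where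
  proper : G.IsProperEdgeColoring σ
  path : ∀ e : Fin 4 → G.edgeSet, G.IsFourPath e → (Set.range (σ ∘ e)).encard ≠ 2
  cycle : ∀ e : Fin 4 → G.edgeSet, G.IsFourCycle e → (Set.range (σ ∘ e)).encard ≠ 2

/-- `G` is star `L`-edge-colorable: there is a star edge-coloring that takes the color of every edge
from the list of that edge. -/
def IsStarListEdgeColorable {α β C : Type*} (G : Graph α β) (L : G.edgeSet → Finset C) : Prop :=
  ∃ σ : G.edgeSet → C, G.IsStarEdgeColoring σ ∧ ∀ e, σ e ∈ L e

/-- `G` is star `k`-edge-choosable: it is star `L`-edge-colorable for every assignment `L` of lists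
with at least `k` colors each, for every type `C` of colors. -/
def IsStarEdgeChoosable {α : Type u} {β : Type v} (G : Graph α β) (k : ℕ) : Prop :=
  ∀ (C : Type w) (L : G.edgeSet → Finset C), (∀ e, k ≤ (L e).card) → G.IsStarListEdgeColorable L

end Graph

/-! By Tutte's theorem some matching `M` of a bridgeless subcubic graph covers all vertices of
degree three: otherwise deleting some set `U` of vertices leaves more than `|U|` odd components of
cubic vertices, each of which sends an odd number of edges to `U`, hence at least three, whereas `U`
receives at most `3|U|`. The edges outside `M` then form paths and cycles, so they are arcs
`v → π v` of a permutation `π` of the vertices.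

Color `M` so that edges of `M` joined by an arc get different colors. If the arc `v → π v` avoids
the colors of the edges of `M` at `π⁻¹ v`, `v`, `π v` and `π² v`, then no edge of `M` lies on a
bichromatic path or cycle with four edges, and at least three colors remain for the arc. From
lists of three colors every cycle of `π` has a star coloring, unless it has length five and all
its lists are the same three colors. To exclude these rigid pentagons as well, an edge of `M` has
to avoid at most six colors: those of four neighboring edges of `M`, and one for each of the two
cycles through its ends. -/

theorem exists_mem_ne_ne {C : Type*} {s : Finset C} (hs : 3 ≤ s.card) (a b : C) :
    ∃ d ∈ s, d ≠ a ∧ d ≠ b := by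
  classical
  have hab : ({a, b} : Finset C).card < s.card := Finset.card_le_two.trans_lt hs
  obtain ⟨d, hd, hdab⟩ := Finset.exists_mem_notMem_of_card_lt_card hab
  exact ⟨d, hd, by simpa only [Finset.mem_insert, Finset.mem_singleton, not_or] using hdab⟩

theorem exists_list_seq {C : Type*} {R : ℕ → Finset C} (hR : ∀ k, 3 ≤ (R k).card)
    {c : C} (hc : c ∈ R 0) :
    ∃ h : ℕ → C, h 0 = c ∧ (∀ k, h k ∈ R k) ∧ (∀ k, h (k + 1) ≠ h k) ∧
      ∀ k, h (k + 2) ≠ h k := by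
  choose next next_mem next_ne₂ next_ne₁ using fun k => exists_mem_ne_ne (hR k)
  let lastTwo : ℕ → C × C := fun k => k.rec (c, c) fun k p => (p.2, next (k + 1) p.1 p.2)
  refine ⟨fun k => (lastTwo k).2, rfl, ?_, fun k => next_ne₁ _ _ _, fun k => next_ne₂ _ _ _⟩
  rintro (_ | k)
  · exact hc
  · exact next_mem _ _ _

/-- `g` is an `n`-periodic word whose letters form a star edge-coloring of the cycle with `n`
edges. It is a word on `ℕ` rather than on `ZMod n`, so that windows of consecutive letters need no
modular arithmetic; windows longer than `n` are exempt. -/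
structure IsCyclicStarWord {C : Type*} (n : ℕ) (g : ℕ → C) : Prop where
  periodic : Function.Periodic g n
  ne : 2 ≤ n → ∀ k, g k ≠ g (k + 1)
  not_alternating : 4 ≤ n → ∀ k, ¬(g k = g (k + 2) ∧ g (k + 1) = g (k + 3))

namespace IsCyclicStarWord

variable {C D : Type*} {n : ℕ}

theorem comp_injOn {g : ℕ → C} (hg : IsCyclicStarWord n g) {i : C → D}
    (hi : Set.InjOn i (Set.range g)) : IsCyclicStarWord n (i ∘ g) := by
  have inj : ∀ k l, i (g k) = i (g l) → g k = g l := fun k l => hi ⟨k, rfl⟩ ⟨l, rfl⟩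
  exact ⟨hg.periodic.comp i, fun hn k h => hg.ne hn k (inj _ _ h),
    fun hn k h => hg.not_alternating hn k ⟨inj _ _ h.1, inj _ _ h.2⟩⟩

theorem of_lt (hn : 0 < n) {h : ℕ → C} (ne : ∀ k, k + 1 < n → h k ≠ h (k + 1))
    (ne_zero : ∀ k, 1 ≤ k → k + 1 = n → h k ≠ h 0)
    (not_alt : ∀ k, k + 3 < n → ¬(h k = h (k + 2) ∧ h (k + 1) = h (k + 3)))
    (not_alt₁ : ∀ k, 1 ≤ k → k + 3 = n → ¬(h k = h (k + 2) ∧ h (k + 1) = h 0))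
    (not_alt₂ : ∀ k, 2 ≤ k → k + 2 = n → ¬(h k = h 0 ∧ h (k + 1) = h 1))
    (not_alt₃ : ∀ k, 3 ≤ k → k + 1 = n → ¬(h k = h 1 ∧ h 0 = h 2)) :
    IsCyclicStarWord n fun k => h (k % n) := by
  have wrap : ∀ r j i, i < n → r + j = n + i → (r + j) % n = i := fun r j i hi hrj => by
    rw [hrj, Nat.add_mod_left, Nat.mod_eq_of_lt hi]
  refine ⟨fun k => by simp only [Nat.add_mod_right], fun hn2 k => ?_, fun hn4 k => ?_⟩ <;>
    have hr := Nat.mod_lt k hn <;> simp only [← Nat.mod_add_mod k n] <;>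
    generalize k % n = r at hr
  · obtain hlt | heq : r + 1 < n ∨ r + 1 = n := by omega
    · rw [Nat.mod_eq_of_lt hlt]
      exact ne r hlt
    · rw [wrap r 1 0 hn heq]
      exact ne_zero r (by omega) heq
  · obtain hlt | h₁ | h₂ | h₃ : r + 3 < n ∨ r + 3 = n ∨ r + 2 = n ∨ r + 1 = n := by omega
    · simpa (disch := omega) only [Nat.mod_eq_of_lt] using not_alt r hlt
    · simpa (disch := omega) only [Nat.mod_eq_of_lt, wrap r 3 0] using not_alt₁ r (by omega) h₁
    · simpa (disch := omega) only [Nat.mod_eq_of_lt, wrap r 2 0, wrap r 3 1]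
        using not_alt₂ r (by omega) h₂
    · simpa (disch := omega) only [wrap r 1 0, wrap r 2 1, wrap r 3 2]
        using not_alt₃ r (by omega) h₃

theorem of_append {m : ℕ} {h : ℕ → C} {d : C} (h_ne₁ : ∀ k, h (k + 1) ≠ h k)
    (h_ne₂ : ∀ k, h (k + 2) ≠ h k) (hd_zero : d ≠ h 0) (hd₁ : d ≠ h (m - 1)) (hd₂ : d ≠ h (m - 2))
    (hd_one : h (m - 1) = h 0 → d ≠ h 1) :
    IsCyclicStarWord (m + 1) fun k => Function.update h m d (k % (m + 1)) := by
  have word_lt : ∀ k, k < m → Function.update h m d k = h k := fun k hk =>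
    Function.update_of_ne hk.ne _ _
  have word_last : ∀ k, k = m → Function.update h m d k = d := by
    rintro k rfl
    exact Function.update_self _ _ _
  refine of_lt m.succ_pos (fun k hk => ?_) (fun k h1k hkm => ?_) (fun k hkm => ?_)
    (fun k h1k hkm => ?_) (fun k h2k hkm => ?_) (fun k h3k hkm => ?_)
  · obtain hlt | heq : k + 1 < m ∨ k + 1 = m := by omega
    · rw [word_lt k (by omega), word_lt _ hlt]
      exact (h_ne₁ k).symm
    · rw [word_lt k (by omega), word_last _ heq, show k = m - 1 by omega]
      exact hd₁.symm
  · rw [word_last k (by omega), word_lt 0 (by omega)]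
    exact hd_zero
  · rw [word_lt k (by omega), word_lt _ (by omega)]
    exact fun h => h_ne₂ k h.1.symm
  · rw [word_lt k (by omega), word_last _ (by omega), show k = m - 2 by omega]
    exact fun h => hd₂ h.1.symm
  · rw [word_lt k (by omega), word_lt 0 (by omega), word_last _ (by omega), word_lt 1 (by omega),
      show k = m - 1 by omega]
    exact fun h => hd_one h.1 h.2
  · rw [word_lt 0 (by omega), word_lt 2 (by omega)]
    exact fun h => h_ne₂ 0 h.2.symm

end IsCyclicStarWord

theorem exists_isCyclicStarWord_of_spare {C : Type*} [DecidableEq C] {m : ℕ} {R : ℕ → Finset C}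
    (hR : ∀ k, 3 ≤ (R k).card) {c : C} (hc : c ∈ R 0) (hspare : 3 ≤ (R m \ {c}).card) :
    ∃ g, IsCyclicStarWord (m + 1) g ∧ ∀ k < m + 1, g k ∈ R k := by
  obtain ⟨h, rfl, h_mem, h_ne₁, h_ne₂⟩ := exists_list_seq hR hc
  -- Excluding `h 1` matters only if `h (m - 1) = h 0`, and then `h (m - 1)` is excluded anyway.
  obtain ⟨d, hd, hd₂, hd₁⟩ := exists_mem_ne_ne hspare (h (m - 2))
    (if h (m - 1) = h 0 then h 1 else h (m - 1))
  rw [Finset.mem_sdiff, Finset.mem_singleton] at hd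
  refine ⟨_, .of_append (m := m) (d := d) h_ne₁ h_ne₂ hd.2 ?_ hd₂ ?_, fun k hk => ?_⟩
  · split_ifs at hd₁ with hm
    · exact hm ▸ hd.2
    · exact hd₁
  · intro hm
    rwa [if_pos hm] at hd₁
  · rw [Nat.mod_eq_of_lt hk]
    obtain rfl | hne := eq_or_ne k m
    · rw [Function.update_self]
      exact hd.1
    · rw [Function.update_of_ne hne]
      exact h_mem k

/-- The three-letter word `(0102)ᵇ(012)ᵃ` of length `n = 4 * b + 3 * a`, where `b = n % 3`, with
letters indexed by `j < n`. Such `a` and `b` exist for all `n` but `1`, `2` and `5`; for `n = 2` the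
word is cut down to `01`. -/
def threeLetterWord (n j : ℕ) : ℕ :=
  if j < 4 * (n % 3) then (if j % 4 = 1 then 1 else if j % 4 = 3 then 2 else 0)
  else (j - 4 * (n % 3)) % 3

theorem threeLetterWord_lt (n j : ℕ) : threeLetterWord n j < 3 := by
  unfold threeLetterWord; split_ifs <;> omega

theorem isCyclicStarWord_threeLetterWord {n : ℕ} (hn : 2 ≤ n) (h5 : n ≠ 5) :
    IsCyclicStarWord n fun k => threeLetterWord n (k % n) := by
  have ne : ∀ j, threeLetterWord n j ≠ threeLetterWord n (j + 1) := by
    intro j; unfold threeLetterWord; split_ifs <;> omega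
  have even_of_eq : ∀ j, threeLetterWord n j = threeLetterWord n (j + 2) → j % 2 = 0 := by
    intro j; unfold threeLetterWord; split_ifs <;> omega
  have at_zero : threeLetterWord n 0 = 0 := by unfold threeLetterWord; split_ifs <;> omega
  have at_one : threeLetterWord n 1 = 1 := by unfold threeLetterWord; split_ifs <;> omega
  have at_last : ∀ k, 2 ≤ k → k + 1 = n → threeLetterWord n k = 2 := by
    intro k; unfold threeLetterWord; split_ifs <;> omega
  have before_last : ∀ k, 2 ≤ k → k + 2 = n → threeLetterWord n k = 0 → n % 4 = 0 := by
    intro k; unfold threeLetterWord; split_ifs <;> omega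
  refine .of_lt (by omega) (fun k _ => ne k) (fun k h1k hkn => ?_) (fun k _ h => ?_)
    (fun k h1k hkn h => ?_) (fun k h2k hkn h => ?_) (fun k h3k hkn h => ?_)
  · obtain rfl | h2k : k = 1 ∨ 2 ≤ k := by omega
    · omega
    · have := at_last k h2k hkn; omega
  · have := even_of_eq _ h.1
    have := even_of_eq _ h.2
    omega
  · have := even_of_eq _ h.1
    have := before_last (k + 1) (by omega) (by omega) (h.2.trans at_zero)
    omega
  · have := at_last (k + 1) (by omega) (by omega); omega
  · have := at_last k (by omega) (by omega); omega

/-- The coloring `c` of the arcs of a permutation, `c v` being the color of the arc `v → π v`, is a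
star coloring on the walk of (up to) four arcs that starts at `v`. -/
def IsStarAt {W C : Type*} (π : Equiv.Perm W) (c : W → C) (v : W) : Prop :=
  (π v ≠ v → c v ≠ c (π v)) ∧
    (π v ≠ v → π (π v) ≠ v → π (π (π v)) ≠ v → ¬(c v = c (π (π v)) ∧ c (π v) = c (π (π (π v)))))

/-- The cycle of `v` is a pentagon whose arcs all have the same list, of size three: the only
obstruction to star coloring the arcs of a permutation from lists of size at least three. -/
def IsRigidPentagon {W C : Type*} (π : Equiv.Perm W) (R : W → Finset C) (v : W) : Prop :=
  Function.minimalPeriod π v = 5 ∧ ∀ u, π.SameCycle v u → (R u).card = 3 ∧ R (π u) = R u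

section ArcColoring

variable {W C : Type*} {π : Equiv.Perm W} {R : W → Finset C}

theorem minimalPeriod_perm_pos [Finite W] (π : Equiv.Perm W) (v : W) :
    0 < Function.minimalPeriod π v :=
  Function.minimalPeriod_pos_of_mem_periodicPts (Function.Injective.mem_periodicPts π.injective v)

theorem exists_iterate_of_sameCycle [Finite W] {v u : W} (h : π.SameCycle v u) :
    ∃ k < Function.minimalPeriod π v, π^[k] v = u := by
  obtain ⟨k, rfl⟩ := h.exists_nat_pow_eq
  exact ⟨k % _, Nat.mod_lt _ (minimalPeriod_perm_pos π v), by
    rw [Function.iterate_mod_minimalPeriod_eq, Equiv.Perm.iterate_eq_pow]⟩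

theorem IsRigidPentagon.of_sameCycle [Finite W] {v u : W}
    (h : IsRigidPentagon π R v) (hu : π.SameCycle v u) : IsRigidPentagon π R u := by
  refine ⟨?_, fun w hw => h.2 w (hu.trans hw)⟩
  obtain ⟨k, -, rfl⟩ := exists_iterate_of_sameCycle hu
  rw [Function.minimalPeriod_apply_iterate
    (Function.minimalPeriod_pos_iff_mem_periodicPts.1 (minimalPeriod_perm_pos π v)), h.1]

theorem IsRigidPentagon.congr {R' : W → Finset C} {v : W} (h : IsRigidPentagon π R v)
    (hR : ∀ u, π.SameCycle v u → R u = R' u) : IsRigidPentagon π R' v := by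
  refine ⟨h.1, fun u hu => ?_⟩
  rw [← hR u hu, ← hR (π u) (Equiv.Perm.sameCycle_apply_right.2 hu)]
  exact h.2 u hu

theorem exists_isStarAt_of_isCyclicStarWord {v : W} {g : ℕ → C}
    (hpos : 0 < Function.minimalPeriod π v) (hg : IsCyclicStarWord (Function.minimalPeriod π v) g) :
    ∃ c : W → C, ∀ k, c (π^[k] v) = g k ∧ IsStarAt π c (π^[k] v) := by
  have hfactor : g.FactorsThrough fun k => π^[k] v := by
    intro i j hij
    dsimp only at hij
    rw [← Function.iterate_mod_minimalPeriod_eq,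
      ← Function.iterate_mod_minimalPeriod_eq (n := j)] at hij
    rw [← hg.periodic.map_mod_nat i, ← hg.periodic.map_mod_nat j,
      Function.iterate_injOn_Iio_minimalPeriod (Nat.mod_lt _ hpos) (Nat.mod_lt _ hpos) hij]
  let c := Function.extend (fun k => π^[k] v) g fun _ => g 0
  have hc : ∀ k, c (π^[k] v) = g k := hfactor.extend_apply _
  have hlt : ∀ n k, (∀ i, 1 ≤ i → i ≤ n → π^[i] (π^[k] v) ≠ π^[k] v) →
      n < Function.minimalPeriod π v := by
    intro n k h
    by_contra! hle
    exact h _ hpos hle ((Function.isPeriodicPt_minimalPeriod π v).apply_iterate k)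
  refine ⟨c, fun k => ⟨hc k, fun h₁ => ?_, fun h₁ h₂ h₃ => ?_⟩⟩
  · rw [← Function.iterate_succ_apply' π, hc, hc]
    refine hg.ne (hlt 1 k fun i hi1 hi => ?_) k
    obtain rfl : i = 1 := by omega
    exact h₁
  · simp only [← Function.iterate_succ_apply' π, hc]
    refine hg.not_alternating (hlt 3 k fun i hi1 hi => ?_) k
    obtain rfl | rfl | rfl : i = 1 ∨ i = 2 ∨ i = 3 := by omega
    exacts [h₁, h₂, h₃]

theorem subset_of_forall_card_sdiff_lt [DecidableEq C] {s t : Finset C} (hs : 3 ≤ s.card)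
    (ht : 3 ≤ t.card) (h : ∀ c ∈ t, (s \ {c}).card < 3) : t ⊆ s ∧ s.card = 3 := by
  have hmem : ∀ c ∈ t, c ∈ s := fun c hc => by
    by_contra hcs
    exact (h c hc).not_ge (by rwa [Finset.sdiff_singleton_eq_erase, Finset.erase_eq_of_notMem hcs])
  obtain ⟨c, hc⟩ : t.Nonempty := Finset.card_pos.1 (by omega)
  have := h c hc
  rw [Finset.sdiff_singleton_eq_erase, Finset.card_erase_of_mem (hmem c hc)] at this
  exact ⟨hmem, by omega⟩

/-- Along a cycle either some list has a color whose use at its arc still leaves three colors at the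
preceding arc, or all lists are the same set of three colors. -/
theorem exists_spare_or_forall_eq [Finite W] [DecidableEq C] (hR : ∀ v, 3 ≤ (R v).card) (v : W) :
    (∃ u, π.SameCycle v u ∧ ∃ c ∈ R (π u), 3 ≤ (R u \ {c}).card) ∨
      ∀ u, π.SameCycle v u → (R u).card = 3 ∧ R (π u) = R u := by
  refine or_iff_not_imp_left.2 fun hspare u hu => ?_
  push Not at hspare
  have hsub : ∀ u, π.SameCycle v u → R (π u) ⊆ R u ∧ (R u).card = 3 := fun u hu =>
    subset_of_forall_card_sdiff_lt (hR u) (hR (π u)) (hspare u hu)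
  refine ⟨(hsub u hu).2, Finset.eq_of_subset_of_card_le (hsub u hu).1 ?_⟩
  rw [(hsub u hu).2, (hsub (π u) (Equiv.Perm.sameCycle_apply_right.2 hu)).2]

theorem exists_isCyclicStarWord_of_three_le_card {n : ℕ} (hn : 0 < n) (h5 : n ≠ 5) {s : Finset C}
    (hs : 3 ≤ s.card) : ∃ g, IsCyclicStarWord n g ∧ ∀ k, g k ∈ s := by
  obtain ⟨i⟩ : Nonempty (Fin 3 ↪ s) := Function.Embedding.nonempty_of_card_le (by simpa using hs)
  obtain rfl | hn2 : n = 1 ∨ 2 ≤ n := by omega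
  · exact ⟨fun _ => i 0, ⟨fun _ => rfl, by omega, by omega⟩, fun _ => (i 0).2⟩
  · refine ⟨_, (isCyclicStarWord_threeLetterWord hn2 h5).comp_injOn
      (i := fun a => (i (Fin.ofNat 3 a) : C)) ?_, fun k => (i _).2⟩
    rintro _ ⟨k, rfl⟩ _ ⟨l, rfl⟩ h
    have hval := congrArg Fin.val (i.injective (Subtype.ext h))
    simpa only [Fin.val_ofNat, Nat.mod_eq_of_lt (threeLetterWord_lt n _)] using hval

theorem exists_isStarAt_of_sameCycle [Finite W] (hR : ∀ v, 3 ≤ (R v).card) {v : W}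
    (hv : ¬IsRigidPentagon π R v) :
    ∃ c : W → C, ∀ u, π.SameCycle v u → c u ∈ R u ∧ IsStarAt π c u := by
  classical
  suffices h : ∃ b, π.SameCycle v b ∧ ∃ g, IsCyclicStarWord (Function.minimalPeriod π b) g ∧
      ∀ k < Function.minimalPeriod π b, g k ∈ R (π^[k] b) by
    obtain ⟨b, hvb, g, hg, hgR⟩ := h
    obtain ⟨c, hc⟩ := exists_isStarAt_of_isCyclicStarWord (minimalPeriod_perm_pos π b) hg
    refine ⟨c, fun u hu => ?_⟩
    obtain ⟨k, hk, rfl⟩ := exists_iterate_of_sameCycle (hvb.symm.trans hu)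
    exact ⟨(hc k).1 ▸ hgR k hk, (hc k).2⟩
  obtain ⟨u, hu, c, hc, hspare⟩ | hconst := exists_spare_or_forall_eq (π := π) hR v
  · refine ⟨π u, Equiv.Perm.sameCycle_apply_right.2 hu, ?_⟩
    obtain ⟨m, hm⟩ := Nat.exists_eq_add_one.2 (minimalPeriod_perm_pos π (π u))
    have hlast : π^[m] (π u) = u := π.injective <| by
      rw [← Function.iterate_succ_apply' π, Nat.succ_eq_add_one, ← hm,
        Function.iterate_minimalPeriod]
    rw [hm]
    exact exists_isCyclicStarWord_of_spare (fun k => hR _) hc (by rwa [hlast])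
  · obtain ⟨g, hg, hgR⟩ := exists_isCyclicStarWord_of_three_le_card
      (minimalPeriod_perm_pos π v) (fun h5 => hv ⟨h5, hconst⟩) (hR v)
    have hiter : ∀ k, π.SameCycle v (π^[k] v) := fun k => ⟨k, by simp [Equiv.Perm.iterate_eq_pow]⟩
    have hlist : ∀ k, R (π^[k] v) = R v := fun k => by
      induction k with
      | zero => rfl
      | succ k ih => rw [Function.iterate_succ_apply', (hconst _ (hiter k)).2, ih]
    exact ⟨v, .refl _ _, g, hg, fun k _ => hlist k ▸ hgR k⟩

theorem exists_list_coloring_isStarAt [Finite W] (hR : ∀ v, 3 ≤ (R v).card)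
    (hpent : ∀ v, ¬IsRigidPentagon π R v) :
    ∃ c : W → C, (∀ v, c v ∈ R v) ∧ ∀ v, IsStarAt π c v := by
  let orbit := Equiv.Perm.SameCycle.setoid π
  let base : W → W := fun v => (Quotient.mk orbit v).out
  have base_sameCycle : ∀ v, π.SameCycle (base v) v := Quotient.mk_out (s := orbit)
  have base_apply : ∀ v, base (π v) = base v := fun v => congrArg Quotient.out <|
    Quotient.sound (Equiv.Perm.sameCycle_apply_left.2 (.refl π v))
  choose c hc using fun v => exists_isStarAt_of_sameCycle hR (hpent v)
  refine ⟨fun v => c (base v) v, fun v => (hc _ v (base_sameCycle v)).1, fun v => ?_⟩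
  have := (hc _ v (base_sameCycle v)).2
  simpa only [IsStarAt, base_apply] using this

end ArcColoring

section MatchingColoring

open Finset

theorem exists_list_coloring_of_recoloring {Q K C : Type*} [Finite Q] [DecidableEq Q]
    {L : Q → Finset C} {scope : K → Set Q} {Good : K → (Q → C) → Prop}
    (hL : ∀ q, (L q).Nonempty)
    (recolor : ∀ f q, ∃ a ∈ L q, ∀ k, q ∈ scope k → Good k (Function.update f q a))
    (good_update : ∀ k f q a, q ∉ scope k → Good k f → Good k (Function.update f q a)) :
    ∃ f : Q → C, (∀ q, f q ∈ L q) ∧ ∀ k, (scope k).Nonempty → Good k f := by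
  cases nonempty_fintype Q
  suffices h : ∀ S : Finset Q, ∃ f : Q → C, (∀ q, f q ∈ L q) ∧
      ∀ k, ∀ q ∈ S, q ∈ scope k → Good k f by
    obtain ⟨f, hf, hgood⟩ := h Finset.univ
    exact ⟨f, hf, fun k ⟨q, hq⟩ => hgood k q (Finset.mem_univ q) hq⟩
  intro S
  induction S using Finset.induction_on with
  | empty => exact ⟨fun q => (hL q).choose, fun q => (hL q).choose_spec, by simp⟩
  | insert q S _ ih =>
    obtain ⟨f, hf, hgood⟩ := ih
    obtain ⟨a, ha, hgood_a⟩ := recolor f q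
    refine ⟨Function.update f q a, fun p => ?_, fun k p hp hpk => ?_⟩
    · obtain rfl | hne := eq_or_ne p q
      · rwa [Function.update_self]
      · rw [Function.update_of_ne hne]
        exact hf p
    · by_cases hqk : q ∈ scope k
      · exact hgood_a k hqk
      · obtain rfl | hpS := Finset.mem_insert.1 hp
        · exact absurd hpk hqk
        · exact good_update k f q a hqk (hgood k p hpS hpk)

theorem subset_and_nodup_of_card_sdiff_le {C : Type*} [DecidableEq C] {s : Finset C}
    {l : List C} (h : (s \ l.toFinset).card + l.length ≤ s.card) : l.toFinset ⊆ s ∧ l.Nodup := by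
  have hcard := Finset.card_sdiff_add_card_inter s l.toFinset
  have hinter := Finset.card_le_card (Finset.inter_subset_right (s₁ := s) (s₂ := l.toFinset))
  have hlen := l.toFinset_card_le
  refine ⟨Finset.inter_eq_right.1
    (Finset.eq_of_subset_of_card_le Finset.inter_subset_right (by omega)), ?_⟩
  exact Multiset.toFinset_card_eq_card_iff_nodup.1 (hlen.antisymm (by omega))

variable {V C : Type*} [DecidableEq C] {π : Equiv.Perm V} {L : V → Finset C} {φ φ' : V → C}

/-- The colors left for the arc `v → π v` when the vertices have the colors `φ` (those of the
matching edges covering them): the arc may not see the color of an end of its own or of an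
adjacent arc. -/
def residualList (π : Equiv.Perm V) (L : V → Finset C) (φ : V → C) (v : V) : Finset C :=
  L v \ [φ (π.symm v), φ v, φ (π v), φ (π (π v))].toFinset

theorem three_le_card_residualList (hL : ∀ v, 7 ≤ (L v).card) (v : V) :
    3 ≤ (residualList π L φ v).card := by
  have := Finset.le_card_sdiff [φ (π.symm v), φ v, φ (π v), φ (π (π v))].toFinset (L v)
  have := hL v
  have := List.toFinset_card_le [φ (π.symm v), φ v, φ (π v), φ (π (π v))]
  simp only [List.length_cons, List.length_nil] at this
  unfold residualList
  omega

theorem residualList_congr {v : V} (hpred : φ (π.symm v) = φ' (π.symm v)) (hself : φ v = φ' v)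
    (hsucc : φ (π v) = φ' (π v)) (hsucc₂ : φ (π (π v)) = φ' (π (π v))) :
    residualList π L φ v = residualList π L φ' v := by
  simp only [residualList, hpred, hself, hsucc, hsucc₂]

theorem IsRigidPentagon.mem_and_nodup (hL : ∀ v, 7 ≤ (L v).card) {w : V}
    (h : IsRigidPentagon π (residualList π L φ) w) :
    φ w ∈ L w ∧ [φ w, φ (π w), φ (π (π w)), φ (π (π (π w))), φ (π.symm w)].Nodup := by
  have hlist : ∀ u, π.SameCycle w u → _ := fun u hu => subset_and_nodup_of_card_sdiff_le
    (s := L u) (l := [φ (π.symm u), φ u, φ (π u), φ (π (π u))])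
    ((congrArg (· + 4) (h.2 u hu).1).trans_le (hL u))
  obtain ⟨hsub, h₀⟩ := hlist w (.refl _ _)
  obtain ⟨-, h₁⟩ := hlist (π w) (Equiv.Perm.sameCycle_apply_right.2 (.refl _ _))
  obtain ⟨-, h₂⟩ := hlist (π (π w))
    (Equiv.Perm.sameCycle_apply_right.2 (Equiv.Perm.sameCycle_apply_right.2 (.refl _ _)))
  have hpred : π.symm w = π (π (π (π w))) := by
    have hcycle := Function.iterate_minimalPeriod (f := π) (x := w)
    rw [h.1] at hcycle
    exact (Equiv.symm_apply_eq π).2 hcycle.symm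
  rw [Equiv.symm_apply_apply, ← hpred] at h₂
  rw [Equiv.symm_apply_apply] at h₁
  refine ⟨hsub (by simp), ?_⟩
  simp only [List.nodup_cons, List.mem_cons, List.not_mem_nil, not_or, or_false] at h₀ h₁ h₂ ⊢
  tauto

/-- Recoloring the vertices that have the color of `w` moves the residual list of `w`, but not that
of `π (π w)`. -/
theorem IsRigidPentagon.eq_of_residualList (hL : ∀ v, 7 ≤ (L v).card) {w : V}
    (h : IsRigidPentagon π (residualList π L φ) w) (h' : IsRigidPentagon π (residualList π L φ') w)
    (hφ : ∀ v, φ v ≠ φ w → φ' v = φ v) : φ w = φ' w := by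
  obtain ⟨hmem, hnodup⟩ := h.mem_and_nodup hL
  obtain ⟨hw, -⟩ := List.nodup_cons.1 hnodup
  have agree : ∀ v, φ v ∈ [φ (π w), φ (π (π w)), φ (π (π (π w))), φ (π.symm w)] → φ' v = φ v :=
    fun v hv => hφ v fun hvw => hw (hvw ▸ hv)
  have agree₁ := agree (π w) (by simp)
  have agree₂ := agree (π (π w)) (by simp)
  have agree₃ := agree (π (π (π w))) (by simp)
  have agree₄ := agree (π.symm w) (by simp)
  have hpred : π (π (π (π w))) = π.symm w := by
    have hcycle := Function.iterate_minimalPeriod (f := π) (x := w)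
    rw [h.1] at hcycle
    exact (Equiv.eq_symm_apply π).2 hcycle
  have hsc : π.SameCycle w (π w) := Equiv.Perm.sameCycle_apply_right.2 (.refl _ _)
  have hres₂ : residualList π L φ (π (π w)) = residualList π L φ' (π (π w)) :=
    residualList_congr (by rw [Equiv.symm_apply_apply, agree₁]) agree₂.symm agree₃.symm
      (by rw [hpred, agree₄])
  have hres : residualList π L φ w = residualList π L φ' w := by
    rw [← (h.2 w (.refl _ _)).2, ← (h.2 _ hsc).2, hres₂, (h'.2 _ hsc).2, (h'.2 w (.refl _ _)).2]
  have hnot_mem : φ w ∉ residualList π L φ' w := hres ▸ by simp [residualList]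
  have hseen : φ w ∈ [φ' (π.symm w), φ' w, φ' (π w), φ' (π (π w))] := by
    by_contra hseen
    exact hnot_mem (Finset.mem_sdiff.2 ⟨hmem, mt List.mem_toFinset.1 hseen⟩)
  rw [agree₁, agree₂, agree₄] at hseen
  simp only [List.mem_cons, List.not_mem_nil, or_false] at hw hseen
  tauto

theorem IsRigidPentagon.of_forall_eq {v : V} (h : IsRigidPentagon π (residualList π L φ) v)
    (hφ : ∀ u, π.SameCycle v u → φ u = φ' u) : IsRigidPentagon π (residualList π L φ') v :=
  h.congr fun _ hu => residualList_congr
    (hφ _ (Equiv.Perm.sameCycle_symm_apply_right.2 hu)) (hφ _ hu)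
    (hφ _ (Equiv.Perm.sameCycle_apply_right.2 hu))
    (hφ _ (Equiv.Perm.sameCycle_apply_right.2 (Equiv.Perm.sameCycle_apply_right.2 hu)))

section Recolor

variable {Q : Type*} [DecidableEq Q] {m : V → Q} {f : Q → C}

theorem IsRigidPentagon.of_update {q : Q} {a : C} {v : V}
    (h : IsRigidPentagon π (residualList π L (Function.update f q a ∘ m)) v)
    (hq : ∀ u, π.SameCycle v u → m u ≠ q) : IsRigidPentagon π (residualList π L (f ∘ m)) v :=
  h.of_forall_eq fun u hu => Function.update_of_ne (hq u hu) _ _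

open Classical in
theorem card_filter_isRigidPentagon_update_le_one (hL : ∀ v, 7 ≤ (L v).card) (f : Q → C)
    (s : Finset C) (u : V) :
    #{a ∈ s | IsRigidPentagon π (residualList π L (Function.update f (m u) a ∘ m)) u} ≤ 1 := by
  refine Finset.card_le_one.2 fun a ha b hb => ?_
  have heq := (Finset.mem_filter.1 ha).2.eq_of_residualList hL (Finset.mem_filter.1 hb).2
    fun v hv => ?_
  · simpa only [Function.comp_apply, Function.update_self] using heq
  · have hne : m v ≠ m u := fun h => hv (congrArg (Function.update f (m u) a) h)
    simp only [Function.comp_apply, Function.update_of_ne hne]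

/-- Each of the at most two vertices `u` with `m u = q` forbids three colors: those of `m` before
and after `u` on its cycle, and at most one that makes this cycle a rigid pentagon. -/
theorem exists_recoloring [Fintype V] {q : Q} (hm : #{v | m v = q} ≤ 2) {s : Finset C}
    (hs : 7 ≤ s.card) (hL : ∀ v, 7 ≤ (L v).card) (f : Q → C) :
    ∃ a ∈ s, ∀ u, m u = q → a ≠ f (m (π u)) ∧ a ≠ f (m (π.symm u)) ∧
      ¬IsRigidPentagon π (residualList π L (Function.update f q a ∘ m)) u := by
  classical
  let forbidden : V → Finset C := fun u => {f (m (π u)), f (m (π.symm u))} ∪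
    {a ∈ s | IsRigidPentagon π (residualList π L (Function.update f (m u) a ∘ m)) u}
  have card_forbidden : ∀ u, #(forbidden u) ≤ 3 := fun u =>
    (Finset.card_union_le _ _).trans (Nat.add_le_add Finset.card_le_two
      (card_filter_isRigidPentagon_update_le_one hL f s u))
  have hcard : #(({v | m v = q} : Finset V).biUnion forbidden) < #s := by
    have := Finset.card_biUnion_le_card_mul {v | m v = q} forbidden 3 fun u _ => card_forbidden u
    omega
  obtain ⟨a, has, ha⟩ := Finset.exists_mem_notMem_of_card_lt_card hcard
  refine ⟨a, has, fun u hu => ?_⟩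
  subst hu
  have := mt (fun h => Finset.mem_biUnion.2 ⟨u, by simp, h⟩) ha
  simpa [forbidden, has, and_assoc] using this

end Recolor

/-- The arcs of `π` are those to be colored, and the matching edge covering `v` is `m v`; matching
edges joined by an arc must differ in color. -/
theorem exists_matching_coloring {Q : Type*} [Fintype V] [Finite Q] [DecidableEq Q] {m : V → Q}
    (hm : ∀ q, #{v | m v = q} ≤ 2) {LM : Q → Finset C} (hLM : ∀ q, 7 ≤ (LM q).card)
    (hL : ∀ v, 7 ≤ (L v).card) :
    ∃ f : Q → C, (∀ q, f q ∈ LM q) ∧ (∀ v, m v ≠ m (π v) → f (m v) ≠ f (m (π v))) ∧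
      ∀ v, ¬IsRigidPentagon π (residualList π L (f ∘ m)) v := by
  let scope : V ⊕ V → Set Q := Sum.elim (fun v => {q | m v = q ∨ m (π v) = q})
    fun v => {q | ∃ u, π.SameCycle v u ∧ m u = q}
  let Good : V ⊕ V → (Q → C) → Prop := Sum.elim (fun v f => m v ≠ m (π v) → f (m v) ≠ f (m (π v)))
    fun v f => ¬IsRigidPentagon π (residualList π L (f ∘ m)) v
  have good_update : ∀ k f q a, q ∉ scope k → Good k f → Good k (Function.update f q a) := by
    rintro (v | v) f q a hq hgood
    · obtain ⟨hv, hπv⟩ := not_or.1 hq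
      simpa only [Good, Sum.elim_inl, Function.update_of_ne hv, Function.update_of_ne hπv]
        using hgood
    · exact fun h => hgood (h.of_update fun u hu hmu => hq ⟨u, hu, hmu⟩)
  have recolor : ∀ f q, ∃ a ∈ LM q, ∀ k, q ∈ scope k → Good k (Function.update f q a) := by
    intro f q
    obtain ⟨a, ha, hgood⟩ := exists_recoloring (π := π) (hm q) (hLM q) hL f
    refine ⟨a, ha, ?_⟩
    rintro (v | v)
    · rintro (rfl | rfl) hne
      · rw [Function.update_self, Function.update_of_ne hne.symm]
        exact (hgood v rfl).1
      · rw [Function.update_self, Function.update_of_ne hne]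
        simpa using (hgood (π v) rfl).2.1.symm
    · rintro ⟨u, hu, rfl⟩ hpent
      exact (hgood u rfl).2.2 (hpent.of_sameCycle hu)
  obtain ⟨f, hf, hgood⟩ := exists_list_coloring_of_recoloring
    (fun q => Finset.card_pos.1 ((hLM q).trans_lt' (by norm_num))) recolor good_update
  exact ⟨f, hf, fun v => hgood (.inl v) ⟨m v, .inl rfl⟩, fun v =>
    hgood (.inr v) ⟨m v, v, .refl _ _, rfl⟩⟩

end MatchingColoring

section Orientation

open Finset

theorem exists_perm_ne_zero_of_sum_eq {n : Type*} [Fintype n] {A : n → n → ℕ} {k : ℕ}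
    (hk : k ≠ 0) (hrow : ∀ i, ∑ j, A i j = k) (hcol : ∀ j, ∑ i, A i j = k) :
    ∃ σ : Equiv.Perm n, ∀ i, A i (σ i) ≠ 0 := by
  suffices hall : ∀ S : Finset n, #S ≤ #{j | ∃ i ∈ S, A i j ≠ 0} by
    obtain ⟨σ, hσ, hA⟩ := (Fintype.all_card_le_filter_rel_iff_exists_injective (A · · ≠ 0)).1 hall
    exact ⟨.ofBijective σ (Finite.injective_iff_bijective.1 hσ), hA⟩
  intro S
  set N : Finset n := {j | ∃ i ∈ S, A i j ≠ 0} with hN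
  refine Nat.le_of_mul_le_mul_right ?_ (Nat.pos_of_ne_zero hk)
  calc #S * k = ∑ i ∈ S, ∑ j, A i j := by simp [hrow]
    _ = ∑ i ∈ S, ∑ j ∈ N, A i j := Finset.sum_congr rfl fun i hi => by
        refine (Finset.sum_subset (Finset.subset_univ N) fun j _ hj => ?_).symm
        by_contra hij
        exact hj (by simpa [hN] using ⟨i, hi, hij⟩)
    _ ≤ ∑ i, ∑ j ∈ N, A i j :=
        Finset.sum_le_sum_of_subset (Finset.subset_univ S)
    _ = #N * k := by rw [Finset.sum_comm]; simp [hcol]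

variable {V E : Type*} [DecidableEq V] [Fintype E] {ends : E → Sym2 V}

/-- The edges at `v` in the multigraph on `V` whose edge `e` joins the two members of `ends e`. -/
def edgesAt (ends : E → Sym2 V) (v : V) : Finset E := {e | v ∈ ends e}

theorem mem_edgesAt {e : E} {v : V} : e ∈ edgesAt ends v ↔ v ∈ ends e := by
  simp [edgesAt]

/-- The tails are a permutation in the support of the matrix that consists of the incidence matrix,
its transpose, and on the diagonal whatever brings the row sums to two. -/
theorem exists_injective_tail [Finite V] (hloop : ∀ e, ¬(ends e).IsDiag)
    (hdeg : ∀ v, #(edgesAt ends v) ≤ 2) :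
    ∃ tail : E → V, Function.Injective tail ∧ (∀ e, tail e ∈ ends e) ∧
      ∀ v, #(edgesAt ends v) = 2 → ∃ e, tail e = v := by
  cases nonempty_fintype V
  let B : Matrix E V ℕ := .of fun e v => if v ∈ ends e then 1 else 0
  let A : Matrix (E ⊕ V) (E ⊕ V) ℕ :=
    .fromBlocks 0 B B.transpose (.diagonal fun v => 2 - #(edgesAt ends v))
  have hsymm : ∀ i j, A i j = A j i := fun i j =>
    congrFun₂ (Matrix.IsSymm.fromBlocks (A := (0 : Matrix E E ℕ)) Matrix.transpose_zero rfl
      (Matrix.isSymm_diagonal _)) j i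
  have hrow : ∀ i, ∑ j, A i j = 2 := by
    rintro (e | v)
    · have : ({v | v ∈ ends e} : Finset V) = (ends e).toFinset := by ext; simp
      simp [A, B, this, Sym2.card_toFinset_of_not_isDiag _ (hloop e)]
    · simpa [A, B, Matrix.diagonal_apply, edgesAt] using Nat.add_sub_cancel' (hdeg v)
  obtain ⟨σ, hσ⟩ := exists_perm_ne_zero_of_sum_eq two_ne_zero hrow fun j => by
    simpa only [hsymm] using hrow j
  have htail : ∀ e, ∃ v, σ (.inl e) = .inr v ∧ v ∈ ends e := fun e => by
    have he := hσ (.inl e)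
    rcases hσe : σ (.inl e) with f | v
    · simp [hσe, A] at he
    · exact ⟨v, rfl, by simpa [hσe, A, B] using he⟩
  choose tail hσ_tail tail_mem using htail
  refine ⟨tail, fun e f hef => ?_, tail_mem, fun v hv => ?_⟩
  · exact Sum.inl_injective (σ.injective (by rw [hσ_tail, hσ_tail, hef]))
  · obtain ⟨e | u, hu⟩ := σ.surjective (.inr v)
    · exact ⟨e, Sum.inr_injective ((hσ_tail e).symm.trans hu)⟩
    · have hAu := hσ (.inr u)
      rw [hu] at hAu
      have huv : u = v := by
        by_contra hne
        exact hAu (Matrix.diagonal_apply_ne (fun v => 2 - #(edgesAt ends v)) hne)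
      subst huv
      simp [A, hv] at hAu

/-- If two edges had the head `v`, the edge with the tail `v` would be a third edge at `v`. -/
theorem exists_perm_forall_eq_mk [Finite V] (hloop : ∀ e, ¬(ends e).IsDiag)
    (hdeg : ∀ v, #(edgesAt ends v) ≤ 2) :
    ∃ (tail : E → V) (π : Equiv.Perm V), Function.Injective tail ∧
      ∀ e, ends e = s(tail e, π (tail e)) := by
  classical
  obtain ⟨tail, tail_inj, tail_mem, htail⟩ := exists_injective_tail hloop hdeg
  let head : E → V := fun e => Sym2.Mem.other (tail_mem e)
  have head_mem : ∀ e, head e ∈ ends e := fun e => Sym2.other_mem _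
  have head_ne : ∀ e, head e ≠ tail e := fun e => Sym2.other_ne (hloop e) _
  have head_inj : Function.Injective head := by
    intro e f hef
    by_contra hne
    have hsub : {e, f} ⊆ edgesAt ends (head e) := by
      simp only [Finset.insert_subset_iff, Finset.singleton_subset_iff, mem_edgesAt]
      exact ⟨head_mem e, hef ▸ head_mem f⟩
    have heq := Finset.eq_of_subset_of_card_le hsub (by simpa [Finset.card_pair hne] using hdeg _)
    obtain ⟨g, hg⟩ := htail (head e) (by rw [← heq, Finset.card_pair hne])
    have hgmem : g ∈ ({e, f} : Finset E) := heq ▸ mem_edgesAt.2 (hg ▸ tail_mem g)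
    obtain rfl | rfl : g = e ∨ g = f := by simpa using hgmem
    · exact head_ne g hg.symm
    · exact head_ne g (hef.symm.trans hg.symm)
  obtain ⟨π, hπ⟩ := Equiv.Perm.exists_extending_pair tail head tail_inj head_inj
  exact ⟨tail, π, tail_inj, fun e => by rw [hπ]; exact (Sym2.other_spec (tail_mem e)).symm⟩

end Orientation

section Matching

open Finset

/-- `K` has an odd number of vertices and is a union of components of `G - U`. -/
structure IsOddIsland {W : Type*} (G : SimpleGraph W) (U K : Finset W) : Prop where
  odd : Odd #K
  disjoint : Disjoint K U
  mem_of_adj : ∀ x ∈ K, ∀ y, G.Adj x y → y ∉ U → y ∈ K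

section Tutte

variable {W : Type*} {G : SimpleGraph W}

theorem exists_isOddIsland_family [Finite W] (G : SimpleGraph W) (u : Set W) [Fintype u] :
    ∃ 𝒦 : Finset (Finset W), (𝒦 : Set (Finset W)).PairwiseDisjoint id ∧
      (∀ K ∈ 𝒦, IsOddIsland G u.toFinset K) ∧
      #𝒦 = ((⊤ : G.Subgraph).deleteVerts u).coe.oddComponents.ncard := by
  classical
  cases nonempty_fintype W
  set Γ := ((⊤ : G.Subgraph).deleteVerts u).coe
  let verts : Γ.ConnectedComponent → Finset W := fun c => (Subtype.val '' c.supp).toFinset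
  have mem_verts : ∀ c w, w ∈ verts c ↔ ∃ x ∈ c.supp, x.1 = w := fun c w => by simp [verts]
  have verts_disjoint : ∀ c d, c ≠ d → Disjoint (verts c) (verts d) := by
    intro c d hne
    refine Finset.disjoint_left.2 fun w hc hd => hne ?_
    obtain ⟨x, hxc, rfl⟩ := (mem_verts c w).1 hc
    obtain ⟨y, hyd, hyx⟩ := (mem_verts d _).1 hd
    obtain rfl := Subtype.ext hyx
    exact hxc.symm.trans hyd
  have verts_nonempty : ∀ c, (verts c).Nonempty := fun c => by
    obtain ⟨x, hx⟩ := c.nonempty_supp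
    exact ⟨x, (mem_verts c x).2 ⟨x, hx, rfl⟩⟩
  have verts_inj : Function.Injective verts := fun c d h => by
    by_contra hne
    exact (verts_nonempty d).ne_empty (disjoint_self.1 (h ▸ verts_disjoint c d hne))
  refine ⟨Γ.oddComponents.toFinset.map ⟨verts, verts_inj⟩, ?_, ?_, ?_⟩
  · simp only [Finset.coe_map, Function.Embedding.coeFn_mk]
    rintro _ ⟨c, -, rfl⟩ _ ⟨d, -, rfl⟩ hcd
    exact verts_disjoint c d (ne_of_apply_ne verts hcd)
  · simp only [Finset.mem_map, Set.mem_toFinset, Function.Embedding.coeFn_mk]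
    rintro _ ⟨c, hc, rfl⟩
    refine ⟨?_, Finset.disjoint_left.2 fun w hw hwu => ?_, fun w hw y hwy hy => ?_⟩
    · rwa [← Set.ncard_eq_toFinset_card', Set.ncard_image_of_injective _ Subtype.val_injective]
    · obtain ⟨x, -, rfl⟩ := (mem_verts c w).1 hw
      exact x.2.2 (Set.mem_toFinset.1 hwu)
    · obtain ⟨x, hx, rfl⟩ := (mem_verts c w).1 hw
      have hyu : y ∉ u := mt Set.mem_toFinset.2 hy
      refine (mem_verts c y).2 ⟨⟨y, trivial, hyu⟩, ?_, rfl⟩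
      have hadj : Γ.Adj x ⟨y, trivial, hyu⟩ :=
        SimpleGraph.Subgraph.deleteVerts_adj.2 ⟨trivial, x.2.2, trivial, hyu, hwy⟩
      exact (SimpleGraph.ConnectedComponent.sound hadj.reachable).symm.trans hx
  · rw [Finset.card_map, Set.ncard_eq_toFinset_card']

/-- Tutte's theorem with an excess of one allowed: the number of odd components of `G - U` has the
parity of `U`. -/
theorem exists_isPerfectMatching_of_even [Fintype W] (heven : Even (Fintype.card W))
    (h : ∀ (U : Finset W) (𝒦 : Finset (Finset W)), (𝒦 : Set (Finset W)).PairwiseDisjoint id →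
      (∀ K ∈ 𝒦, IsOddIsland G U K) → #𝒦 ≤ #U + 1) :
    ∃ M : G.Subgraph, M.IsPerfectMatching := by
  classical
  refine SimpleGraph.tutte.2 fun u hu => ?_
  obtain ⟨𝒦, hdisj, hisland, hcard⟩ := exists_isOddIsland_family G u
  have hle := h u.toFinset 𝒦 hdisj hisland
  have hpar := SimpleGraph.odd_ncard_oddComponents (G := ((⊤ : G.Subgraph).deleteVerts u).coe)
  have hverts : Nat.card ((⊤ : G.Subgraph).deleteVerts u).verts + u.ncard = Fintype.card W := by
    rw [SimpleGraph.Subgraph.deleteVerts_verts, SimpleGraph.Subgraph.verts_top,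
      Nat.card_coe_set_eq, ← Set.compl_eq_univ_sdiff, add_comm, Set.ncard_add_ncard_compl,
      Nat.card_eq_fintype_card]
  rw [SimpleGraph.IsTutteViolator] at hu
  rw [← Set.ncard_eq_toFinset_card'] at hle
  rw [Nat.odd_iff, Nat.odd_iff] at hpar
  rw [Nat.even_iff] at heven
  omega

end Tutte

variable {V : Type*} {H : SimpleGraph V} {S : Set V}

/-- An even number of vertices is reached by adding a copy of `V`; all vertices whose covering is
optional, old or new, are joined to each other. -/
def optionalCoverGraph (H : SimpleGraph V) (S : Set V) : SimpleGraph (V ⊕ V) :=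
  H.map .inl ⊔ .fromRel fun a b => a ∉ Sum.inl '' S ∧ b ∉ Sum.inl '' S

theorem IsOddIsland.toLeft {U K : Finset (V ⊕ V)} (hK : IsOddIsland (optionalCoverGraph H S) U K)
    (hKS : ∀ a ∈ K, a ∈ Sum.inl '' S) : IsOddIsland H U.toLeft K.toLeft ∧ ↑K.toLeft ⊆ S := by
  refine ⟨⟨?_, Finset.disjoint_left.2 fun x hx hxU => ?_, fun x hx y hxy hy => ?_⟩, fun x hx => ?_⟩
  · have hright : K.toRight = ∅ := Finset.eq_empty_of_forall_notMem fun y hy => by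
      obtain ⟨x, -, hxy⟩ := hKS _ (Finset.mem_toRight.1 hy)
      exact Sum.inl_ne_inr hxy
    have := K.card_toLeft_add_card_toRight
    rw [hright, Finset.card_empty, add_zero] at this
    exact this ▸ hK.odd
  · exact Finset.disjoint_left.1 hK.disjoint (Finset.mem_toLeft.1 hx) (Finset.mem_toLeft.1 hxU)
  · have hadj : (optionalCoverGraph H S).Adj (.inl x) (.inl y) :=
      .inl (SimpleGraph.map_adj_apply' hxy (Sum.inl_injective.ne hxy.ne))
    exact Finset.mem_toLeft.2 (hK.mem_of_adj _ (Finset.mem_toLeft.1 hx) _ hadj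
      (mt Finset.mem_toLeft.2 hy))
  · obtain ⟨y, hy, hyx⟩ := hKS _ (Finset.mem_toLeft.1 hx)
    exact Sum.inl_injective hyx ▸ hy

theorem IsOddIsland.not_disjoint_of_optional {U K K' : Finset (V ⊕ V)}
    (hK : IsOddIsland (optionalCoverGraph H S) U K)
    (hK' : IsOddIsland (optionalCoverGraph H S) U K') (hKS : ¬∀ a ∈ K, a ∈ Sum.inl '' S)
    (hKS' : ¬∀ a ∈ K', a ∈ Sum.inl '' S) : ¬Disjoint K K' := by
  push Not at hKS hKS'
  obtain ⟨a, haK, ha⟩ := hKS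
  obtain ⟨b, hbK, hb⟩ := hKS'
  refine Finset.not_disjoint_iff.2 ⟨b, ?_, hbK⟩
  obtain rfl | hne := eq_or_ne a b
  · exact haK
  · refine hK.mem_of_adj a haK b (.inr ?_) (Finset.disjoint_left.1 hK'.disjoint hbK)
    exact (SimpleGraph.fromRel_adj _ _ _).2 ⟨hne, .inl ⟨ha, hb⟩⟩

theorem card_le_of_isOddIsland_optionalCoverGraph
    (h : ∀ (U : Finset V) (𝒦 : Finset (Finset V)), (𝒦 : Set (Finset V)).PairwiseDisjoint id →
      (∀ K ∈ 𝒦, IsOddIsland H U K ∧ ↑K ⊆ S) → #𝒦 ≤ #U)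
    {U : Finset (V ⊕ V)} {𝒦 : Finset (Finset (V ⊕ V))}
    (hdisj : (𝒦 : Set (Finset (V ⊕ V))).PairwiseDisjoint id)
    (hisland : ∀ K ∈ 𝒦, IsOddIsland (optionalCoverGraph H S) U K) : #𝒦 ≤ #U + 1 := by
  classical
  have hspecial : #{K ∈ 𝒦 | ¬∀ a ∈ K, a ∈ Sum.inl '' S} ≤ 1 := by
    refine Finset.card_le_one.2 fun K hK K' hK' => ?_
    obtain ⟨hK, hKS⟩ := Finset.mem_filter.1 hK
    obtain ⟨hK', hKS'⟩ := Finset.mem_filter.1 hK'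
    by_contra hne
    exact (hisland K hK).not_disjoint_of_optional (hisland K' hK') hKS hKS' (hdisj hK hK' hne)
  have hleft_inj : Set.InjOn Finset.toLeft
      {K | K ∈ 𝒦 ∧ ∀ a ∈ K, a ∈ Sum.inl '' S} := by
    rintro K ⟨hK, hKS⟩ K' ⟨hK', -⟩ heq
    by_contra hne
    obtain ⟨x, hx⟩ := Finset.card_pos.1 ((hisland K hK).toLeft hKS).1.odd.pos
    exact Finset.disjoint_left.1 (hdisj hK hK' hne) (Finset.mem_toLeft.1 hx)
      (Finset.mem_toLeft.1 (heq ▸ hx))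
  have hordinary : #{K ∈ 𝒦 | ∀ a ∈ K, a ∈ Sum.inl '' S} ≤ #U.toLeft := by
    rw [← Finset.card_image_of_injOn (by simpa using hleft_inj)]
    refine h _ _ ?_ fun K hK => ?_
    · rw [Finset.coe_image]
      rintro _ ⟨K, hK, rfl⟩ _ ⟨K', hK', rfl⟩ hne
      have := hdisj (Finset.mem_filter.1 hK).1 (Finset.mem_filter.1 hK').1 (ne_of_apply_ne _ hne)
      exact Finset.disjoint_left.2 fun x hx hx' =>
        Finset.disjoint_left.1 this (Finset.mem_toLeft.1 hx) (Finset.mem_toLeft.1 hx')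
    · obtain ⟨K, hK', rfl⟩ := Finset.mem_image.1 hK
      obtain ⟨hK, hKS⟩ := Finset.mem_filter.1 hK'
      exact (hisland K hK).toLeft hKS
  have := Finset.card_filter_add_card_filter_not (s := 𝒦)
    fun K => ∀ a ∈ K, a ∈ Sum.inl '' S
  have := U.card_toLeft_add_card_toRight
  omega

theorem exists_isMatching_of_forall_card_le [Finite V]
    (h : ∀ (U : Finset V) (𝒦 : Finset (Finset V)), (𝒦 : Set (Finset V)).PairwiseDisjoint id →
      (∀ K ∈ 𝒦, IsOddIsland H U K ∧ ↑K ⊆ S) → #𝒦 ≤ #U) :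
    ∃ M : H.Subgraph, M.IsMatching ∧ S ⊆ M.verts := by
  cases nonempty_fintype V
  obtain ⟨P, hP⟩ := exists_isPerfectMatching_of_even (G := optionalCoverGraph H S)
    (by simp) fun U 𝒦 => card_le_of_isOddIsland_optionalCoverGraph h
  rw [SimpleGraph.Subgraph.isPerfectMatching_iff] at hP
  let M : H.Subgraph :=
    { verts := {x | ∃ y, H.Adj x y ∧ P.Adj (.inl x) (.inl y)}
      Adj := fun x y => H.Adj x y ∧ P.Adj (.inl x) (.inl y)
      adj_sub := And.left
      edge_vert := fun hxy => ⟨_, hxy⟩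
      symm := ⟨fun _ _ hxy => ⟨hxy.1.symm, hxy.2.symm⟩⟩ }
  refine ⟨M, fun x ⟨y, hxy⟩ => ⟨y, hxy, fun z hxz => ?_⟩, fun x hx => ?_⟩
  · exact Sum.inl_injective ((hP (.inl x)).unique hxz.2 hxy.2)
  · obtain ⟨b, hb, -⟩ := hP (.inl x)
    obtain hH | hopt := P.adj_sub hb
    · obtain ⟨-, x', y, hxy, hx', rfl⟩ := (SimpleGraph.map_adj' _ _ _ _).1 hH
      exact ⟨y, Sum.inl_injective hx' ▸ hxy, hb⟩
    · obtain ⟨-, h | h⟩ := (SimpleGraph.fromRel_adj _ _ _).1 hopt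
      exacts [absurd ⟨x, hx, rfl⟩ h.1, absurd ⟨x, hx, rfl⟩ h.2]

end Matching

section CubicMatching

open Finset

variable {V E : Type*} [Fintype V] [DecidableEq V] [Fintype E] {ends : E → Sym2 V}

/-- The edges with exactly one end in `K`. -/
def edgeCut (ends : E → Sym2 V) (K : Finset V) : Finset E :=
  {e | ∃ x ∈ K, ∃ y ∉ K, ends e = s(x, y)}

theorem mem_edgeCut {K : Finset V} {e : E} :
    e ∈ edgeCut ends K ↔ ∃ x ∈ K, ∃ y ∉ K, ends e = s(x, y) := by
  simp [edgeCut]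

theorem odd_card_filter_mem_ends_iff (hloop : ∀ e, ¬(ends e).IsDiag) (K : Finset V) (e : E) :
    Odd #{v ∈ K | v ∈ ends e} ↔ e ∈ edgeCut ends K := by
  have hne := hloop e
  rw [mem_edgeCut]
  induction h : ends e with | _ x y
  rw [h, Sym2.mk_isDiag_iff] at hne
  have hfilter : {v ∈ K | v ∈ s(x, y)} = K ∩ {x, y} := by ext v; simp
  rw [hfilter]
  by_cases hx : x ∈ K <;> by_cases hy : y ∈ K
  · rw [Finset.inter_eq_right.2 (by simp [Finset.insert_subset_iff, hx, hy]), Finset.card_pair hne]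
    refine iff_of_false (by decide) ?_
    rintro ⟨a, -, b, hb, hab⟩
    have : b ∈ s(x, y) := hab ▸ Sym2.mem_mk_right a b
    obtain rfl | rfl := Sym2.mem_iff.1 this <;> contradiction
  · simp only [Finset.inter_insert_of_mem hx, Finset.inter_singleton_of_notMem hy]
    exact iff_of_true (by simp) ⟨x, hx, y, hy, rfl⟩
  · simp only [Finset.inter_insert_of_notMem hx, Finset.inter_singleton_of_mem hy]
    exact iff_of_true (by simp) ⟨y, hy, x, hx, Sym2.eq_swap⟩
  · simp only [Finset.inter_insert_of_notMem hx, Finset.inter_singleton_of_notMem hy]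
    refine iff_of_false (by simp) ?_
    rintro ⟨a, ha, b, -, hab⟩
    have : a ∈ s(x, y) := hab ▸ Sym2.mem_mk_left a b
    obtain rfl | rfl := Sym2.mem_iff.1 this <;> contradiction

theorem odd_sum_card_edgesAt_iff (hloop : ∀ e, ¬(ends e).IsDiag) (K : Finset V) :
    Odd (∑ v ∈ K, #(edgesAt ends v)) ↔ Odd #(edgeCut ends K) := by
  have hdouble : ∑ v ∈ K, #(edgesAt ends v) = ∑ e, #{v ∈ K | v ∈ ends e} :=
    Finset.sum_card_bipartiteAbove_eq_sum_card_bipartiteBelow fun v e => v ∈ ends e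
  have hcut : ({e | Odd #{v ∈ K | v ∈ ends e}} : Finset E) = edgeCut ends K := by
    ext e
    simp [odd_card_filter_mem_ends_iff hloop]
  rw [hdouble, Finset.odd_sum_iff_odd_card_odd, hcut]

theorem three_le_card_edgeCut (hloop : ∀ e, ¬(ends e).IsDiag) {K : Finset V} (hK : Odd #K)
    (hcubic : ∀ v ∈ K, #(edgesAt ends v) = 3) (hcut : #(edgeCut ends K) ≠ 1) :
    3 ≤ #(edgeCut ends K) := by
  have hodd : Odd #(edgeCut ends K) := by
    rw [← odd_sum_card_edgesAt_iff hloop, Finset.sum_congr rfl hcubic, Finset.sum_const]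
    exact hK.mul (by decide)
  obtain ⟨k, hk⟩ := hodd
  omega

theorem IsOddIsland.exists_of_mem_edgeCut {U K : Finset V}
    (hK : IsOddIsland (.fromEdgeSet (Set.range ends)) U K) {e : E} (he : e ∈ edgeCut ends K) :
    ∃ x ∈ K, ∃ y ∈ U, ends e = s(x, y) := by
  obtain ⟨x, hx, y, hy, hxy⟩ := mem_edgeCut.1 he
  refine ⟨x, hx, y, ?_, hxy⟩
  by_contra hyU
  have hadj : (SimpleGraph.fromEdgeSet (Set.range ends)).Adj x y :=
    (SimpleGraph.fromEdgeSet_adj _).2 ⟨⟨e, hxy⟩, ne_of_mem_of_not_mem hx hy⟩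
  exact hy (hK.mem_of_adj x hx y hadj hyU)

theorem IsOddIsland.disjoint_edgeCut {U K K' : Finset V}
    (hK : IsOddIsland (.fromEdgeSet (Set.range ends)) U K)
    (hK' : IsOddIsland (.fromEdgeSet (Set.range ends)) U K') (hdisj : Disjoint K K') :
    Disjoint (edgeCut ends K) (edgeCut ends K') := by
  refine Finset.disjoint_left.2 fun e he he' => ?_
  obtain ⟨x, hx, y, hy, hxy⟩ := hK.exists_of_mem_edgeCut he
  obtain ⟨x', hx', y', -, hxy'⟩ := hK'.exists_of_mem_edgeCut he'
  have : x' ∈ s(x, y) := hxy ▸ hxy' ▸ Sym2.mem_mk_left x' y'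
  obtain rfl | rfl := Sym2.mem_iff.1 this
  · exact Finset.disjoint_left.1 hdisj hx hx'
  · exact Finset.disjoint_left.1 hK'.disjoint hx' hy

/-- Each island is left by at least three edges, and each vertex of `U` is entered by at most
three. -/
theorem card_le_of_isOddIsland_cubic (hloop : ∀ e, ¬(ends e).IsDiag)
    (hdeg : ∀ v, #(edgesAt ends v) ≤ 3) (hcut : ∀ K, #(edgeCut ends K) ≠ 1) {U : Finset V}
    {𝒦 : Finset (Finset V)} (hdisj : (𝒦 : Set (Finset V)).PairwiseDisjoint id)
    (h𝒦 : ∀ K ∈ 𝒦, IsOddIsland (.fromEdgeSet (Set.range ends)) U K ∧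
      ↑K ⊆ {v | #(edgesAt ends v) = 3}) : #𝒦 ≤ #U := by
  classical
  refine Nat.le_of_mul_le_mul_right ?_ (Nat.zero_lt_succ 2)
  calc #𝒦 * 3 ≤ ∑ K ∈ 𝒦, #(edgeCut ends K) :=
        Finset.card_nsmul_le_sum _ _ _ fun K hK =>
          three_le_card_edgeCut hloop (h𝒦 K hK).1.odd (h𝒦 K hK).2 (hcut K)
    _ = #(𝒦.biUnion (edgeCut ends)) := (Finset.card_biUnion fun K hK K' hK' hne =>
        (h𝒦 K hK).1.disjoint_edgeCut (h𝒦 K' hK').1 (hdisj hK hK' hne)).symm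
    _ ≤ #(U.biUnion (edgesAt ends)) := Finset.card_le_card fun e he => by
        obtain ⟨K, hK, he⟩ := Finset.mem_biUnion.1 he
        obtain ⟨x, -, y, hy, hxy⟩ := (h𝒦 K hK).1.exists_of_mem_edgeCut he
        exact Finset.mem_biUnion.2 ⟨y, hy, mem_edgesAt.2 (hxy ▸ Sym2.mem_mk_right x y)⟩
    _ ≤ #U * 3 := Finset.card_biUnion_le_card_mul _ _ _ fun v _ => hdeg v

/-- A matching of the multigraph `ends`. -/
def IsEdgeMatching {V E : Type*} (ends : E → Sym2 V) (M : Set E) : Prop :=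
  ∀ e ∈ M, ∀ f ∈ M, ∀ v, v ∈ ends e → v ∈ ends f → e = f

theorem exists_isEdgeMatching_of_isMatching {V E : Type*} {ends : E → Sym2 V}
    {M : (SimpleGraph.fromEdgeSet (Set.range ends)).Subgraph} (hM : M.IsMatching) :
    ∃ F, IsEdgeMatching ends F ∧ ∀ v ∈ M.verts, ∃ e ∈ F, v ∈ ends e := by
  obtain ⟨F, hF, hbij⟩ := Set.exists_subset_bijOn (ends ⁻¹' M.edgeSet) ends
  refine ⟨F, fun e he f hf v hve hvf => hbij.injOn he hf ?_, fun v hv => ?_⟩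
  · obtain ⟨x, hx⟩ := Sym2.mem_iff_exists.1 hve
    obtain ⟨y, hy⟩ := Sym2.mem_iff_exists.1 hvf
    have hvx : M.Adj v x := by simpa [hx] using hF he
    have hvy : M.Adj v y := by simpa [hy] using hF hf
    rw [hx, hy, hM.eq_of_adj_left hvx hvy]
  · obtain ⟨w, hw, -⟩ := hM hv
    obtain ⟨⟨e, he⟩, -⟩ := (SimpleGraph.fromEdgeSet_adj _).1 (M.adj_sub hw)
    obtain ⟨f, hf, hfe⟩ := hbij.surjOn ⟨e, by simpa [he] using hw, rfl⟩
    exact ⟨f, hf, by rw [hfe, he]; exact Sym2.mem_mk_left v w⟩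

theorem exists_isEdgeMatching_of_cubic (hloop : ∀ e, ¬(ends e).IsDiag)
    (hdeg : ∀ v, #(edgesAt ends v) ≤ 3) (hcut : ∀ K, #(edgeCut ends K) ≠ 1) :
    ∃ M, IsEdgeMatching ends M ∧ ∀ v, #(edgesAt ends v) = 3 → ∃ e ∈ M, v ∈ ends e := by
  obtain ⟨P, hP, hcover⟩ := exists_isMatching_of_forall_card_le fun _ _ hdisj h𝒦 =>
    card_le_of_isOddIsland_cubic hloop hdeg hcut hdisj h𝒦
  obtain ⟨M, hM, hMP⟩ := exists_isEdgeMatching_of_isMatching hP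
  exact ⟨M, hM, fun v hv => hMP v (hcover hv)⟩

end CubicMatching

section ArcCover

variable {V E : Type*} {ends : E → Sym2 V} {F : Set E} {π : Equiv.Perm V} {tail : E → V}

/-- The edges in `F` are distinct arcs `v → π v` of the permutation `π`, the edge `e` being the arc
that starts in `tail e`. -/
structure IsArcCover (ends : E → Sym2 V) (F : Set E) (π : Equiv.Perm V) (tail : E → V) :
    Prop where
  injOn : Set.InjOn tail F
  ends_eq : ∀ e ∈ F, ends e = s(tail e, π (tail e))

/-- The edge `e` is the arc `x → y` of the permutation `π`. -/
def IsArc (π : Equiv.Perm V) (tail : E → V) (e : E) (x y : V) : Prop :=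
  tail e = x ∧ π x = y

namespace IsArcCover

theorem isArc_or_isArc (h : IsArcCover ends F π tail) {e : E} (he : e ∈ F) {x y : V}
    (hxy : ends e = s(x, y)) : IsArc π tail e x y ∨ IsArc π tail e y x := by
  rw [h.ends_eq e he, Sym2.eq_iff] at hxy
  obtain ⟨rfl, rfl⟩ | ⟨rfl, rfl⟩ := hxy
  exacts [.inl ⟨rfl, rfl⟩, .inr ⟨rfl, rfl⟩]

theorem isArc_next (h : IsArcCover ends F π tail) {e f : E} (he : e ∈ F) (hf : f ∈ F)
    (hne : e ≠ f) {x y z : V} (hxy : IsArc π tail e x y) (hyz : ends f = s(y, z)) :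
    IsArc π tail f y z := by
  refine (h.isArc_or_isArc hf hyz).resolve_right fun hzy => hne (h.injOn he hf ?_)
  rw [hxy.1, hzy.1, π.injective (hxy.2.trans hzy.2.symm)]

theorem isArc_prev (h : IsArcCover ends F π tail) {e f : E} (he : e ∈ F) (hf : f ∈ F)
    (hne : e ≠ f) {x y z : V} (hyx : IsArc π tail e y x) (hyz : ends f = s(y, z)) :
    IsArc π tail f z y :=
  (h.isArc_or_isArc hf hyz).resolve_left fun hf' => hne (h.injOn he hf (hyx.1.trans hf'.1.symm))

end IsArcCover

open Finset in
theorem card_edgesAt_compl_le_two [Fintype E] [DecidableEq V] {M : Set E} [DecidablePred (· ∈ M)]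
    (hdeg : ∀ v, #(edgesAt ends v) ≤ 3)
    (hM : ∀ v, #(edgesAt ends v) = 3 → ∃ e ∈ M, v ∈ ends e) (v : V) :
    #(edgesAt (fun e : {e // e ∉ M} => ends e) v) ≤ 2 := by
  have hsub : (edgesAt (fun e : {e // e ∉ M} => ends e) v).map (.subtype _) ⊆ edgesAt ends v := by
    intro e he
    obtain ⟨f, hf, rfl⟩ := Finset.mem_map.1 he
    exact mem_edgesAt.2 ((mem_edgesAt (ends := fun e : {e // e ∉ M} => ends e)).1 hf)
  rw [← Finset.card_map (.subtype _)]
  obtain hlt | h3 := (hdeg v).lt_or_eq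
  · exact (Finset.card_le_card hsub).trans (Nat.le_of_lt_succ hlt)
  · obtain ⟨e, he, hev⟩ := hM v h3
    refine Nat.le_of_lt_succ
      ((Finset.card_lt_card (hsub.ssubset_of_ne fun heq => ?_)).trans_eq h3)
    obtain ⟨f, -, rfl⟩ := Finset.mem_map.1 (heq ▸ mem_edgesAt.2 hev)
    exact f.2 he

open Finset in
theorem exists_isArcCover_compl [Finite V] [Fintype E] [DecidableEq V] {M : Set E}
    (hloop : ∀ e, ¬(ends e).IsDiag) (hdeg : ∀ v, #(edgesAt ends v) ≤ 3)
    (hM : ∀ v, #(edgesAt ends v) = 3 → ∃ e ∈ M, v ∈ ends e) :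
    ∃ π tail, IsArcCover ends Mᶜ π tail := by
  classical
  obtain ⟨tail, π, tail_inj, h⟩ := exists_perm_forall_eq_mk (fun e : {e // e ∉ M} => hloop e)
    (card_edgesAt_compl_le_two hdeg hM)
  let tail' : E → V := Function.extend Subtype.val tail fun e => (ends e).out.1
  have htail : ∀ e, tail' e.1 = tail e := Subtype.val_injective.extend_apply tail _
  refine ⟨π, tail', fun e he f hf hef => ?_, fun e he => ?_⟩
  · rw [htail ⟨e, he⟩, htail ⟨f, hf⟩] at hef
    exact congrArg Subtype.val (tail_inj hef)
  · rw [htail ⟨e, he⟩]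
    exact h ⟨e, he⟩

end ArcCover

section StarColoring

variable {V E C : Type*} {ends : E → Sym2 V}

/-- `e 0, …, e 3` are the consecutive edges of a path with vertices `x 0, …, x 4`, or of a cycle
with four edges if `x 0 = x 4`. -/
structure IsFourTrail (ends : E → Sym2 V) (e : Fin 4 → E) (x : Fin 5 → V) : Prop where
  ends_eq : ∀ i, ends (e i) = s(x i.castSucc, x i.succ)
  ne : ∀ i j, i < j → (i, j) ≠ (0, 4) → x i ≠ x j

theorem ne_of_ends_eq {e f : E} {x y z : V} (he : ends e = s(x, y)) (hf : ends f = s(y, z))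
    (hxz : x ≠ z) : e ≠ f := by
  rintro rfl
  rw [he, Sym2.eq_iff] at hf
  obtain ⟨rfl, rfl⟩ | ⟨rfl, -⟩ := hf <;> exact hxz rfl

theorem IsFourTrail.reverse {e : Fin 4 → E} {x : Fin 5 → V} (h : IsFourTrail ends e x) :
    IsFourTrail ends (e ∘ Fin.rev) (x ∘ Fin.rev) where
  ends_eq i := by
    simp only [Function.comp_apply, Fin.rev_castSucc, Fin.rev_succ, h.ends_eq, Sym2.eq_swap]
  ne i j hij hne := (h.ne _ _ (Fin.rev_lt_rev.2 hij) fun heq => hne <| by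
    rw [Prod.mk.injEq, Fin.rev_eq_iff, Fin.rev_eq_iff] at heq
    exact Prod.ext heq.2 heq.1).symm

theorem IsFourTrail.ne_succ {e : Fin 4 → E} {x : Fin 5 → V} (h : IsFourTrail ends e x) (i : Fin 3) :
    e i.castSucc ≠ e i.succ := by
  refine ne_of_ends_eq (h.ends_eq i.castSucc) (h.ends_eq i.succ) (h.ne _ _ ?_ ?_) <;>
    revert i <;> decide

theorem IsFourTrail.isArc_or_isArc {e : Fin 4 → E} {x : Fin 5 → V} (h : IsFourTrail ends e x)
    {F : Set E} {π : Equiv.Perm V} {tail : E → V} (hF : IsArcCover ends F π tail)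
    (he : ∀ i, e i ∈ F) :
    (∀ i, IsArc π tail (e i) (x i.castSucc) (x i.succ)) ∨
      ∀ i, IsArc π tail (e i) (x i.succ) (x i.castSucc) :=
  (hF.isArc_or_isArc (he 0) (h.ends_eq 0)).imp
    (fun h₀ i => i.induction h₀ fun i hi =>
      hF.isArc_next (he _) (he _) (h.ne_succ i) hi (h.ends_eq i.succ))
    (fun h₀ i => i.induction h₀ fun i hi =>
      hF.isArc_prev (he _) (he _) (h.ne_succ i) hi (h.ends_eq i.succ))

/-- A star edge-coloring of the multigraph `ends`. Under a proper coloring a path or cycle with four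
edges is bichromatic only if its colors alternate. -/
structure IsStarColoring (ends : E → Sym2 V) (σ : E → C) : Prop where
  ne : ∀ e f v, v ∈ ends e → v ∈ ends f → e ≠ f → σ e ≠ σ f
  not_alternating : ∀ e x, IsFourTrail ends e x → ¬(σ (e 0) = σ (e 2) ∧ σ (e 1) = σ (e 3))

/-- The edge-coloring `σ` is assembled from a coloring of a matching `M` and a coloring of the other
edges, which are arcs of a permutation `π`: `φ v` is the color of the edge of `M` at `v` (and
arbitrary if there is none), and `c v` is the color of the arc `v → π v`. -/
structure IsAssembledColoring (ends : E → Sym2 V) (M : Set E) (π : Equiv.Perm V) (tail : E → V)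
    (φ c : V → C) (σ : E → C) : Prop where
  isEdgeMatching : IsEdgeMatching ends M
  isArcCover : IsArcCover ends Mᶜ π tail
  eq_of_mem : ∀ e ∈ M, ∀ v ∈ ends e, σ e = φ v
  eq_of_notMem : ∀ e ∉ M, σ e = c (tail e)
  ne_arc : ∀ v, π v ≠ v → (∀ e ∈ M, ends e ≠ s(v, π v)) → φ v ≠ φ (π v)
  notMem_arc : ∀ v, c v ∉ [φ (π.symm v), φ v, φ (π v), φ (π (π v))]
  isStarAt : ∀ v, IsStarAt π c v

namespace IsAssembledColoring

variable {M : Set E} {π : Equiv.Perm V} {tail : E → V} {φ c : V → C} {σ : E → C}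

theorem ne_of_mem_of_notMem (h : IsAssembledColoring ends M π tail φ c σ) {e f : E} (he : e ∈ M)
    (hf : f ∉ M) {v : V} (hev : v ∈ ends e) (hfv : v ∈ ends f) : σ e ≠ σ f := by
  rw [h.eq_of_mem e he v hev, h.eq_of_notMem f hf]
  rw [h.isArcCover.ends_eq f hf, Sym2.mem_iff] at hfv
  have hnotMem := h.notMem_arc (tail f)
  simp only [List.mem_cons, not_or, ← ne_eq] at hnotMem
  obtain rfl | rfl := hfv
  exacts [hnotMem.2.1.symm, hnotMem.2.2.1.symm]

theorem ne_of_isArc (h : IsAssembledColoring ends M π tail φ c σ) {e f : E} (he : e ∉ M)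
    (hf : f ∉ M) (hne : e ≠ f) {x y z : V} (hxy : IsArc π tail e x y) (hyz : IsArc π tail f y z) :
    σ e ≠ σ f := by
  rw [h.eq_of_notMem e he, h.eq_of_notMem f hf, hxy.1, hyz.1, ← hxy.2]
  refine (h.isStarAt x).1 fun hx => hne (h.isArcCover.injOn he hf ?_)
  rw [hxy.1, hyz.1, ← hxy.2, hx]

theorem ne (h : IsAssembledColoring ends M π tail φ c σ) (e f : E) (v : V) (hev : v ∈ ends e)
    (hfv : v ∈ ends f) (hne : e ≠ f) : σ e ≠ σ f := by
  by_cases he : e ∈ M <;> by_cases hf : f ∈ M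
  · exact absurd (h.isEdgeMatching e he f hf v hev hfv) hne
  · exact h.ne_of_mem_of_notMem he hf hev hfv
  · exact (h.ne_of_mem_of_notMem hf he hfv hev).symm
  · obtain ⟨x, hx⟩ := Sym2.mem_iff_exists.1 hev
    obtain ⟨y, hy⟩ := Sym2.mem_iff_exists.1 hfv
    obtain hvx | hxv := h.isArcCover.isArc_or_isArc he hx
    · exact (h.ne_of_isArc hf he hne.symm (h.isArcCover.isArc_prev he hf hne hvx hy) hvx).symm
    · exact h.ne_of_isArc he hf hne hxv (h.isArcCover.isArc_next he hf hne hxv hy)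

theorem notMem_of_eq (h : IsAssembledColoring ends M π tail φ c σ) {e₁ e₂ e₃ : E} {x₀ x₁ x₂ x₃ : V}
    (h₁ : ends e₁ = s(x₀, x₁)) (h₂ : ends e₂ = s(x₁, x₂)) (h₃ : ends e₃ = s(x₂, x₃))
    (h₀₂ : x₀ ≠ x₂) (h₁₂ : x₁ ≠ x₂) (h₁₃ : x₁ ≠ x₃) (heq : σ e₁ = σ e₃) : e₁ ∉ M := by
  intro he₁
  have hx₁ : x₁ ∈ ends e₁ := h₁ ▸ Sym2.mem_mk_right _ _
  have hx₂ : x₂ ∈ ends e₃ := h₃ ▸ Sym2.mem_mk_left _ _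
  have he₂ : e₂ ∉ M := fun he₂ => ne_of_ends_eq h₁ h₂ h₀₂
    (h.isEdgeMatching e₁ he₁ e₂ he₂ x₁ hx₁ (h₂ ▸ Sym2.mem_mk_left _ _))
  have hparallel : ∀ e ∈ M, ends e ≠ s(x₁, x₂) := fun e he hee₂ =>
    ne_of_ends_eq h₁ hee₂ h₀₂ (h.isEdgeMatching e₁ he₁ e he x₁ hx₁ (hee₂ ▸ Sym2.mem_mk_left _ _))
  have harc := h.isArcCover.isArc_or_isArc he₂ h₂
  rw [h.eq_of_mem e₁ he₁ x₁ hx₁] at heq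
  by_cases he₃ : e₃ ∈ M
  · rw [h.eq_of_mem e₃ he₃ x₂ hx₂] at heq
    obtain ⟨-, rfl⟩ | ⟨-, rfl⟩ := harc
    · exact h.ne_arc x₁ h₁₂.symm hparallel heq
    · exact h.ne_arc x₂ h₁₂ (fun e he => Sym2.eq_swap ▸ hparallel e he) heq.symm
  · rw [h.eq_of_notMem e₃ he₃] at heq
    refine h.notMem_arc (tail e₃) (heq ▸ ?_)
    have hne := ne_of_ends_eq h₂ h₃ h₁₃
    obtain harc | harc := harc
    · rw [(h.isArcCover.isArc_next he₂ he₃ hne harc h₃).1, ← harc.2]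
      simp
    · have hprev := h.isArcCover.isArc_prev he₂ he₃ hne harc h₃
      rw [hprev.1, hprev.2, harc.2]
      simp

theorem not_alternating_of_isArc (h : IsAssembledColoring ends M π tail φ c σ) {e : Fin 4 → E}
    {x : Fin 5 → V} (he : ∀ i, e i ∉ M) (hx : ∀ i, IsArc π tail (e i) (x i.castSucc) (x i.succ))
    (hne : ∀ i j, i < j → (i, j) ≠ (0, 4) → x i ≠ x j) :
    ¬(σ (e 0) = σ (e 2) ∧ σ (e 1) = σ (e 3)) := by
  have h₁ : π (x 0) = x 1 := (hx 0).2
  have h₂ : π (x 1) = x 2 := (hx 1).2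
  have h₃ : π (x 2) = x 3 := (hx 2).2
  have hσ : ∀ i, σ (e i) = c (x i.castSucc) := fun i => by rw [h.eq_of_notMem _ (he i), (hx i).1]
  have hstar := (h.isStarAt (x 0)).2
  rw [h₁, h₂, h₃] at hstar
  rw [hσ, hσ, hσ, hσ]
  exact hstar (hne 0 1 (by decide) (by decide)).symm
    (hne 0 2 (by decide) (by decide)).symm (hne 0 3 (by decide) (by decide)).symm

theorem notMem_of_alternating (h : IsAssembledColoring ends M π tail φ c σ) {e : Fin 4 → E}
    {x : Fin 5 → V} (hex : IsFourTrail ends e x) (h₀₂ : σ (e 0) = σ (e 2))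
    (h₁₃ : σ (e 1) = σ (e 3)) : e 0 ∉ M ∧ e 1 ∉ M :=
  ⟨h.notMem_of_eq (hex.ends_eq 0) (hex.ends_eq 1) (hex.ends_eq 2)
    (hex.ne 0 2 (by decide) (by decide)) (hex.ne 1 2 (by decide) (by decide))
    (hex.ne 1 3 (by decide) (by decide)) h₀₂,
  h.notMem_of_eq (hex.ends_eq 1) (hex.ends_eq 2) (hex.ends_eq 3)
    (hex.ne 1 3 (by decide) (by decide)) (hex.ne 2 3 (by decide) (by decide))
    (hex.ne 2 4 (by decide) (by decide)) h₁₃⟩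

theorem isStarColoring (h : IsAssembledColoring ends M π tail φ c σ) : IsStarColoring ends σ := by
  refine ⟨h.ne, fun e x hex ⟨h₀₂, h₁₃⟩ => ?_⟩
  obtain ⟨he₀, he₁⟩ := h.notMem_of_alternating hex h₀₂ h₁₃
  obtain ⟨he₃, he₂⟩ := h.notMem_of_alternating hex.reverse h₁₃.symm h₀₂.symm
  have he : ∀ i, e i ∉ M := fun i => by fin_cases i <;> assumption
  obtain hforward | hbackward := hex.isArc_or_isArc h.isArcCover he
  · exact h.not_alternating_of_isArc he hforward hex.ne ⟨h₀₂, h₁₃⟩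
  · refine h.not_alternating_of_isArc (fun i => he i.rev) (fun i => ?_) hex.reverse.ne
      ⟨h₁₃.symm, h₀₂.symm⟩
    simpa only [Function.comp_apply, Fin.rev_castSucc, Fin.rev_succ] using hbackward i.rev

end IsAssembledColoring

end StarColoring

section MultigraphChoosability

open Finset

variable {V E C : Type*} {ends : E → Sym2 V}

open Classical in
/-- The index of the vertex `v` among the color classes of vertices that a coloring of the matching
`M` determines: the edge of `M` at `v`, or `v` itself if there is none. -/
noncomputable def matchIndex (ends : E → Sym2 V) (M : Set E) (v : V) : E ⊕ V :=
  if h : ∃ e ∈ M, v ∈ ends e then .inl h.choose else .inr v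

theorem matchIndex_eq_inl_iff {M : Set E} (hM : IsEdgeMatching ends M) {v : V} {e : E} :
    matchIndex ends M v = .inl e ↔ e ∈ M ∧ v ∈ ends e := by
  unfold matchIndex
  split_ifs with h
  · obtain ⟨hmem, hv⟩ := h.choose_spec
    rw [Sum.inl.injEq]
    exact ⟨by rintro rfl; exact ⟨hmem, hv⟩, fun he => hM _ hmem e he.1 v hv he.2⟩
  · exact iff_of_false id fun he => h ⟨e, he⟩

theorem eq_of_matchIndex_eq_inr {M : Set E} {v w : V} (h : matchIndex ends M v = .inr w) :
    v = w := by
  unfold matchIndex at h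
  split_ifs at h
  exact Sum.inr_injective h

theorem card_filter_matchIndex_eq_le_two [Fintype V] [DecidableEq V] [DecidableEq E] {M : Set E}
    (hM : IsEdgeMatching ends M) (q : E ⊕ V) : #{v | matchIndex ends M v = q} ≤ 2 := by
  obtain e | w := q
  · refine (Finset.card_le_card (t := (ends e).toFinset) fun v hv => ?_).trans ?_
    · rw [Finset.mem_filter_univ, matchIndex_eq_inl_iff hM] at hv
      exact Sym2.mem_toFinset.2 hv.2
    · rw [Sym2.card_toFinset]
      split_ifs <;> decide
  · refine (Finset.card_le_card (t := {w}) fun v hv => ?_).trans (by simp)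
    rw [Finset.mem_filter_univ] at hv
    exact Finset.mem_singleton.2 (eq_of_matchIndex_eq_inr hv)

theorem matchIndex_ne {M : Set E} (hM : IsEdgeMatching ends M) {v w : V} (hvw : v ≠ w)
    (h : ∀ e ∈ M, ends e ≠ s(v, w)) : matchIndex ends M v ≠ matchIndex ends M w := by
  intro heq
  rcases hw : matchIndex ends M w with e | u
  · obtain ⟨he, hwe⟩ := (matchIndex_eq_inl_iff hM).1 hw
    obtain ⟨-, hve⟩ := (matchIndex_eq_inl_iff hM).1 (heq.trans hw)
    exact h e he ((Sym2.mem_and_mem_iff hvw).1 ⟨hve, hwe⟩)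
  · exact hvw ((eq_of_matchIndex_eq_inr (heq.trans hw)).trans (eq_of_matchIndex_eq_inr hw).symm)

theorem exists_isStarColoring_of_isArcCover [Finite V] [Finite E] {M : Set E}
    {π : Equiv.Perm V} {tail : E → V} (hM : IsEdgeMatching ends M)
    (hF : IsArcCover ends Mᶜ π tail) {L : E → Finset C} (hL : ∀ e, 7 ≤ #(L e)) :
    ∃ σ, (∀ e, σ e ∈ L e) ∧ IsStarColoring ends σ := by
  classical
  cases nonempty_fintype V
  cases isEmpty_or_nonempty E
  · exact ⟨isEmptyElim, isEmptyElim, isEmptyElim, fun e => isEmptyElim (e 0)⟩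
  let LM : E ⊕ V → Finset C := Sum.elim L fun _ => L (Classical.arbitrary E)
  let LF : V → Finset C := fun v => L (Function.invFunOn tail Mᶜ v)
  obtain ⟨f, hf, hf_ne, hf_pent⟩ := exists_matching_coloring (π := π)
    (card_filter_matchIndex_eq_le_two hM) (LM := LM) (by rintro (_ | _) <;> exact hL _)
    (L := LF) fun _ => hL _
  set φ : V → C := f ∘ matchIndex ends M
  obtain ⟨c, hc, hc_star⟩ := exists_list_coloring_isStarAt
    (three_le_card_residualList (π := π) (φ := φ) (L := LF) fun _ => hL _) hf_pent
  simp only [residualList, Finset.mem_sdiff, List.mem_toFinset] at hc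
  let σ : E → C := fun e => if e ∈ M then f (.inl e) else c (tail e)
  have hσ : IsAssembledColoring ends M π tail φ c σ :=
    { isEdgeMatching := hM
      isArcCover := hF
      eq_of_mem := fun e he v hv => by
        simp only [σ, φ, if_pos he, Function.comp_apply, (matchIndex_eq_inl_iff hM).2 ⟨he, hv⟩]
      eq_of_notMem := fun e he => if_neg he
      ne_arc := fun v hv h => hf_ne v (matchIndex_ne hM hv.symm h)
      notMem_arc := fun v => (hc v).2
      isStarAt := hc_star }
  refine ⟨σ, fun e => ?_, hσ.isStarColoring⟩
  by_cases he : e ∈ M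
  · simpa only [σ, if_pos he, LM, Sum.elim_inl] using hf (.inl e)
  · have hmem := (hc (tail e)).1
    simp only [LF, hF.injOn.leftInvOn_invFunOn he] at hmem
    simpa only [σ, if_neg he] using hmem

theorem exists_isStarColoring [Fintype V] [DecidableEq V] [Fintype E]
    (hloop : ∀ e, ¬(ends e).IsDiag) (hdeg : ∀ v, #(edgesAt ends v) ≤ 3)
    (hcut : ∀ K, #(edgeCut ends K) ≠ 1) {L : E → Finset C} (hL : ∀ e, 7 ≤ #(L e)) :
    ∃ σ, (∀ e, σ e ∈ L e) ∧ IsStarColoring ends σ := by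
  obtain ⟨M, hM, hcubic⟩ := exists_isEdgeMatching_of_cubic hloop hdeg hcut
  obtain ⟨π, tail, hF⟩ := exists_isArcCover_compl hloop hdeg hcubic
  exact exists_isStarColoring_of_isArcCover hM hF hL

end MultigraphChoosability

section Transfer

variable {α : Type u} {β : Type v} {G : Graph α β}

/-- The multigraph `G` presented by the unordered pairs of ends of its edges. -/
noncomputable def linkEnds (G : Graph α β) (e : G.edgeSet) : Sym2 G.vertexSet :=
  have h := G.exists_isLink_of_mem_edgeSet e.2
  s(⟨h.choose, h.choose_spec.choose_spec.left_mem⟩,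
    ⟨h.choose_spec.choose, h.choose_spec.choose_spec.right_mem⟩)

theorem linkEnds_eq_iff {e : G.edgeSet} {x y : G.vertexSet} :
    linkEnds G e = s(x, y) ↔ G.IsLink (e : β) x y := by
  rw [(G.exists_isLink_of_mem_edgeSet e.2).choose_spec.choose_spec.isLink_iff_sym2_eq,
    ← (Sym2.map.injective Subtype.val_injective).eq_iff]
  simp only [linkEnds, Sym2.map_mk]

theorem mem_linkEnds_iff {e : G.edgeSet} {x : G.vertexSet} :
    x ∈ linkEnds G e ↔ G.Inc (e : β) x := by
  simp only [Sym2.mem_iff_exists, linkEnds_eq_iff]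
  exact ⟨fun ⟨y, h⟩ => ⟨y, h⟩, fun ⟨y, h⟩ => ⟨⟨y, h.right_mem⟩, h⟩⟩

theorem not_isDiag_linkEnds (hloop : G.Loopless) (e : G.edgeSet) : ¬(linkEnds G e).IsDiag := by
  induction h : linkEnds G e with | _ x y
  rw [Sym2.mk_isDiag_iff]
  rintro rfl
  exact hloop.not_isLoopAt _ _ (linkEnds_eq_iff.1 h)

theorem finite_edgeSet_of_isSubcubic (hfin : G.vertexSet.Finite) (hsub : G.IsSubcubic) :
    G.edgeSet.Finite := by
  refine (hfin.biUnion (t := G.incidenceSet) fun v hv =>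
    Set.finite_of_encard_le_coe (k := 3) (hsub v hv)).subset fun e he => ?_
  obtain ⟨x, y, hxy⟩ := G.exists_isLink_of_mem_edgeSet he
  exact Set.mem_biUnion hxy.left_mem hxy.inc_left

theorem card_edgesAt_linkEnds_le_three [Fintype G.edgeSet] [DecidableEq G.vertexSet]
    (hsub : G.IsSubcubic) (v : G.vertexSet) : (edgesAt (linkEnds G) v).card ≤ 3 := by
  have hincidence : Subtype.val '' (edgesAt (linkEnds G) v : Set G.edgeSet) ⊆
      G.incidenceSet v := by
    rintro _ ⟨e, he, rfl⟩
    exact mem_linkEnds_iff.1 (mem_edgesAt.1 he)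
  have hcard := (Set.encard_le_encard hincidence).trans (hsub v v.2)
  rw [Subtype.val_injective.encard_image, Set.encard_coe_eq_coe_finsetCard] at hcard
  exact_mod_cast hcard

/-- No edge is a bridge: the ends of an edge stay joined by a walk after its deletion. -/
def IsBridgeless (G : Graph α β) : Prop :=
  ∀ e x y, G.IsLink e x y → Relation.ReflTransGen (G.deleteEdges {e}).Adj x y

theorem card_edgeCut_linkEnds_ne_one [Fintype G.vertexSet] [DecidableEq G.vertexSet]
    [Fintype G.edgeSet] (hG : IsBridgeless G) (K : Finset G.vertexSet) :
    (edgeCut (linkEnds G) K).card ≠ 1 := by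
  intro hcard
  obtain ⟨e, hcut⟩ := Finset.card_eq_one.1 hcard
  obtain ⟨x, hx, y, hy, hxy⟩ := mem_edgeCut.1 (hcut ▸ Finset.mem_singleton_self e)
  have reachable : ∀ z, Relation.ReflTransGen (G.deleteEdges {(e : β)}).Adj x z →
      ∃ z' ∈ K, (z' : α) = z := by
    intro z hz
    induction hz with
    | refl => exact ⟨x, hx, rfl⟩
    | @tail _ b _ hab ih =>
      obtain ⟨a, ha, rfl⟩ := ih
      obtain ⟨f, hf⟩ := hab
      obtain ⟨hf, hfe⟩ := (Graph.deleteEdges_isLink ..).mp hf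
      refine ⟨⟨b, hf.right_mem⟩, by_contra fun hb => hfe ?_, rfl⟩
      have hmem : ⟨f, hf.edge_mem⟩ ∈ edgeCut (linkEnds G) K :=
        mem_edgeCut.2 ⟨a, ha, _, hb, linkEnds_eq_iff.2 hf⟩
      rw [hcut, Finset.mem_singleton] at hmem
      exact congrArg Subtype.val hmem
  obtain ⟨y', hy', heq⟩ := reachable y (hG e x y (linkEnds_eq_iff.1 hxy))
  exact hy (Subtype.ext heq ▸ hy')

theorem alternating_of_encard_range_eq_two {C : Type*} {f : Fin 4 → C}
    (hf : (Set.range f).encard = 2) (h : ∀ i : Fin 3, f i.castSucc ≠ f i.succ) :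
    f 0 = f 2 ∧ f 1 = f 3 := by
  obtain ⟨a, b, -, hab⟩ := Set.encard_eq_two.1 hf
  have hor : ∀ i, f i = a ∨ f i = b := fun i => hab.subset ⟨i, rfl⟩
  have two_step : ∀ i j k, f i ≠ f j → f j ≠ f k → f i = f k := by
    intro i j k hij hjk
    rcases hor i with hi | hi <;> rcases hor j with hj | hj <;> rcases hor k with hk | hk <;>
      simp_all
  exact ⟨two_step 0 1 2 (h 0) (h 1), two_step 1 2 3 (h 1) (h 2)⟩

namespace IsStarColoring

variable {C : Type*}

theorem encard_range_ne_two {V E : Type*} {ends : E → Sym2 V} {σ : E → C}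
    (hσ : IsStarColoring ends σ) {e : Fin 4 → E} {x : Fin 5 → V} (h : IsFourTrail ends e x) :
    (Set.range (σ ∘ e)).encard ≠ 2 := fun h2 =>
  hσ.not_alternating e x h <| alternating_of_encard_range_eq_two h2 fun i =>
    hσ.ne _ _ (x i.castSucc.succ) (h.ends_eq i.castSucc ▸ Sym2.mem_mk_right _ _)
      (h.ends_eq i.succ ▸ Sym2.mem_mk_left _ _) (h.ne_succ i)

theorem isStarEdgeColoring {σ : G.edgeSet → C} (hσ : IsStarColoring (linkEnds G) σ) :
    G.IsStarEdgeColoring σ where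
  proper e f hef x he hf := hσ.ne e f ⟨x, he.vertex_mem⟩ (mem_linkEnds_iff.2 he)
    (mem_linkEnds_iff.2 hf) hef
  path := by
    rintro e ⟨x, hx, hlink⟩
    have hmem : ∀ i, x i ∈ G.vertexSet :=
      Fin.cases (hlink 0).left_mem fun i => (hlink i).right_mem
    refine hσ.encard_range_ne_two (x := fun i => ⟨x i, hmem i⟩)
      ⟨fun i => linkEnds_eq_iff.2 (hlink i), fun i j hij _ => ?_⟩
    exact Subtype.coe_ne_coe.1 (hx.ne hij.ne)
  cycle := by
    rintro e ⟨x, hx, hlink⟩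
    refine hσ.encard_range_ne_two (x := fun i => ⟨x (Fin.ofNat 4 i), (hlink _).left_mem⟩)
      ⟨fun i => linkEnds_eq_iff.2 ?_, fun i j hij hne => Subtype.coe_ne_coe.1 (hx.ne ?_)⟩
    · fin_cases i <;> exact hlink _
    · revert i j
      decide

end IsStarColoring

end Transfer

theorem lemma2p3_general {α : Type u} {β : Type v} (G : Graph α β) (hfin : G.vertexSet.Finite)
    (hloop : G.Loopless) (hsub : G.IsSubcubic) (hbridge : IsBridgeless G) :
    Graph.IsStarEdgeChoosable.{u, v, w} G 7 := by
  classical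
  intro C L hL
  have := hfin.fintype
  have := (finite_edgeSet_of_isSubcubic hfin hsub).fintype
  obtain ⟨σ, hσL, hσ⟩ := exists_isStarColoring (not_isDiag_linkEnds hloop)
    (card_edgesAt_linkEnds_le_three hsub) (card_edgeCut_linkEnds_ne_one hbridge) hL
  exact ⟨σ, hσ.isStarEdgeColoring, hσL⟩

theorem lemma2p3 {α : Type u} {β : Type v} (G : Graph α β) (hfin : G.vertexSet.Finite)
    (hloop : G.Loopless) (hsub : G.IsSubcubic) (h2con : G.IsTwoConnected) :
    Graph.IsStarEdgeChoosable.{u, v, w} G 7 :=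
  lemma2p3_general G hfin hloop hsub fun e x y h =>
    (h2con.connected_deleteEdge e h.edge_mem).2 x h.left_mem y h.right_mem
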